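/- **Setting.** Let $W\colon\mathbb{R}\to\mathbb{R}$ be a double-well potential: $W$ is continuous, there are $\alpha_W,\beta_W>0$ with $\alpha_W(1-|z|)^2\le W(z)\le \beta_W(1-|z|)^2$ for $|z|\le 2$, and $\inf_{|z|\ge 2}W(z)>0$. Let $k\in\mathbb{N}=\{0,1,2,\dots\}$ and $s\in(0,1)$ with $k+s>\tfrac12$. Let $a\colon\mathbb{R}^2\to\mathbb{R}$ be a homogenization kernel: $a$ is measurable, $1$-periodic in each of its two variables, with $\operatorname{ess\,inf}a>0$ and $\operatorname{ess\,sup}a<+\infty$. Let $H^{k+s}_{\mathrm{loc}}(\mathbb{R})$ be the space of functions $v$ whose weak derivatives $v^{(j)}$, $0\le j\le k$, exist and belong to $L^2_{\mathrm{loc}}(\mathbb{R})$ and for which $\int_I\int_I \frac{|v^{(k)}(x)-v^{(k)}(y)|^2}{|x-y|^{1+2s}}\,dx\,dy<\infty$ for every bounded open interval $I$; since $k+s>\tfrac12$, each such $v$ is identified with its continuous representative. For $v\in H^{k+s}_{\mathrm{loc}}(\mathbb{R})$ put $$\Phi^a(v)=\int_{\mathbb{R}}W(v(x))\,dx+\int_{\mathbb{R}}\int_{\mathbb{R}}a(x,y)\,\frac{|v^{(k)}(x)-v^{(k)}(y)|^2}{|x-y|^{1+2s}}\,dx\,dy\in[0,+\infty],$$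 and for $\omega\in\{\pm1\}$ and $T>0$ define $$m^\omega(a,T)=\inf\big\{\Phi^a(v)\;\big|\; v\in H^{k+s}_{\mathrm{loc}}(\mathbb{R}),\ v(x)=\omega\operatorname{sgn}(x)\text{ for }|x|>T\big\},$$ $$m^\omega(a)=\inf\big\{\Phi^a(v)\;\big|\; v\in H^{k+s}_{\mathrm{loc}}(\mathbb{R}),\ \lim_{x\to\pm\infty}v(x)=\pm\omega\big\}.$$ **Corollary 4.4.** For every homogenization kernel $a$ and every $\omega\in\{\pm1\}$, $$m^\omega(a)=\lim_{T\to+\infty}m^\omega(a,T)=\inf_{T>0}m^\omega(a,T).$$ -/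

import Mathlib

open Set Filter Topology MeasureTheory
open scoped ENNReal

noncomputable section

namespace FracPhase

/-- A (regular) double-well potential: a continuous `W : ℝ → ℝ` comparable with `(1 - |z|)²` for
`|z| ≤ 2` and bounded below by a positive constant for `|z| ≥ 2`. -/
structure IsDoubleWell (W : ℝ → ℝ) : Prop where
  continuous : Continuous W
  bounds : ∃ α β : ℝ, 0 < α ∧ 0 < β ∧
    ∀ z : ℝ, |z| ≤ 2 → α * (1 - |z|) ^ 2 ≤ W z ∧ W z ≤ β * (1 - |z|) ^ 2
  far : ∃ c : ℝ, 0 < c ∧ ∀ z : ℝ, 2 ≤ |z| → c ≤ W z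

/-- A homogenization kernel: a Lebesgue measurable function on `ℝ²`, `1`-periodic in each variable,
with positive essential infimum and finite essential supremum. -/
structure IsKernel (a : ℝ × ℝ → ℝ) : Prop where
  aemeasurable : AEMeasurable a volume
  periodic_left : ∀ x y : ℝ, a (x + 1, y) = a (x, y)
  periodic_right : ∀ x y : ℝ, a (x, y + 1) = a (x, y)
  bounds : ∃ α β : ℝ, 0 < α ∧ ∀ᵐ p : ℝ × ℝ, α ≤ a p ∧ a p ≤ β

/-- `g` is the weak (distributional) derivative of order `j` of `u` on `ℝ`. -/
def IsWeakDeriv (j : ℕ) (u g : ℝ → ℝ) : Prop :=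
  LocallyIntegrable u volume ∧ LocallyIntegrable g volume ∧
    ∀ φ : ℝ → ℝ, ContDiff ℝ ((⊤ : ℕ∞) : WithTop ℕ∞) φ → HasCompactSupport φ →
      ∫ x, u x * iteratedDeriv j φ x = (-1) ^ j * ∫ x, g x * φ x

open Classical in
/-- The weak derivative `u⁽ʲ⁾` (unique up to null sets); the value is `0` if there is none. -/
def weakDeriv (j : ℕ) (u : ℝ → ℝ) : ℝ → ℝ :=
  if h : ∃ g, IsWeakDeriv j u g then h.choose else 0

/-- The weighted Gagliardo energy
`∫_I ∫_I a(x, y) |g(x) - g(y)|² / |x - y|^(1 + 2s) dx dy`, with values in `[0, ∞]`. -/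
def gagliardo (a : ℝ × ℝ → ℝ) (s : ℝ) (I : Set ℝ) (g : ℝ → ℝ) : ℝ≥0∞ :=
  ∫⁻ p in I ×ˢ I, ENNReal.ofReal (a p * (|g p.1 - g p.2| ^ 2 / |p.1 - p.2| ^ (1 + 2 * s)))

/-- `u ∈ H^{k+s}_loc(ℝ)`: the weak derivatives of order `0, …, k` exist and are square integrable
on bounded intervals, and `u⁽ᵏ⁾` has finite Gagliardo seminorm on every bounded interval. -/
structure MemHLoc (k : ℕ) (s : ℝ) (u : ℝ → ℝ) : Prop where
  exists_weakDeriv : ∀ j ≤ k, ∃ g, IsWeakDeriv j u g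
  memLp : ∀ j ≤ k, ∀ R : ℝ, MemLp (weakDeriv j u) 2 (volume.restrict (Ioo (-R) R))
  seminorm_lt_top : ∀ R : ℝ, gagliardo (fun _ => 1) s (Ioo (-R) R) (weakDeriv k u) < ∞

/-- The energy `Φ^a(v, I) = ∫_I W(v) dx + ∫_I ∫_I a(x, y) |v⁽ᵏ⁾(x) - v⁽ᵏ⁾(y)|² / |x - y|^(1 + 2s)`,
with values in `[0, ∞]` (a double-well potential is nonnegative, a kernel is positive a.e.). -/
def energyOn (W : ℝ → ℝ) (k : ℕ) (s : ℝ) (a : ℝ × ℝ → ℝ) (v : ℝ → ℝ) (I : Set ℝ) : ℝ≥0∞ :=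
  (∫⁻ x in I, ENNReal.ofReal (W (v x))) + gagliardo a s I (weakDeriv k v)

/-- `Φ^a(v) = Φ^a(v, ℝ)`. -/
def energy (W : ℝ → ℝ) (k : ℕ) (s : ℝ) (a : ℝ × ℝ → ℝ) (v : ℝ → ℝ) : ℝ≥0∞ :=
  energyOn W k s a v univ

/-- The profiles for infinite length: `v ∈ H^{k+s}_loc(ℝ)`, identified with its continuous
representative (which exists as `k + s > 1/2`), with `v(x) → ±ω` as `x → ±∞`. -/
def profiles (k : ℕ) (s ω : ℝ) : Set (ℝ → ℝ) :=
  {v | MemHLoc k s v ∧ Continuous v ∧ Tendsto v atTop (𝓝 ω) ∧ Tendsto v atBot (𝓝 (-ω))}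

/-- The profiles for length `T`: `v ∈ H^{k+s}_loc(ℝ)`, identified with its continuous
representative, with `v(x) = ω sgn(x)` for `|x| > T`. -/
def profilesAt (k : ℕ) (s ω T : ℝ) : Set (ℝ → ℝ) :=
  {v | MemHLoc k s v ∧ Continuous v ∧ ∀ x : ℝ, T < |x| → v x = ω * Real.sign x}

/-- The transition energy `m^ω(a)` at infinite length. -/
def transitionEnergy (W : ℝ → ℝ) (k : ℕ) (s : ℝ) (a : ℝ × ℝ → ℝ) (ω : ℝ) : ℝ≥0∞ :=
  ⨅ v ∈ profiles k s ω, energy W k s a v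

/-- The transition energy `m^ω(a, T)` at length `T`. -/
def transitionEnergyAt (W : ℝ → ℝ) (k : ℕ) (s : ℝ) (a : ℝ × ℝ → ℝ) (ω T : ℝ) : ℝ≥0∞ :=
  ⨅ v ∈ profilesAt k s ω T, energy W k s a v

end FracPhase

end

/-! A profile of finite length is a profile, so the infimum over finite lengths is at least
`transitionEnergy`. Conversely, each profile `v` of finite energy must be approximated in energy by
finite-length ones. With `u = v - ω * smoothSign`, the approximants are `v - θ_n * u`, where `θ_n =
farCutoff n` vanishes on `[-n, n]` and is one beyond `n + 1`. Everything reduces to showing that the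
removed tail `θ_n * u` costs nothing in the limit.

First, `u` lies in `H^{k+s}(ℝ)`. The lower quadratic bound on `W` near the wells turns finite
potential energy into `u ∈ L²` (`sqNorm_sub_smoothSign_lt_top`), and the lower bound on `a` gives a
finite seminorm of `v⁽ᵏ⁾`. The intermediate derivatives follow by interpolation
(`IsWeakDeriv.sqNorm_lt_top`): a mollification of a derivative is controlled by `u`, and the
mollification error by short increments.

Secondly, multiplication by `θ_n` tends strongly to zero on `H^s`, by dominated convergence in the
increment form of the seminorm (`IsNullMultiplier.sqSemi_mul`). The product rule lifts this to order
`k` (`IsNullMultiplier.exists_isWeakDeriv`).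

Finally, `gagliardo_sub_le` bounds the nonlocal energy of the approximant by `1 + δ` times that of
`v` plus a vanishing term, and the upper quadratic bound on `W` gives convergence of the potential
energies (`tendsto_lintegral_potential`). Letting `n → ∞` and then `δ → 0` gives the missing
inequality; monotonicity in `T` identifies the infimum with the limit. -/

noncomputable section

namespace FracPhase

/-! ### Calculus of weak derivatives on the line -/

section WeakDerivative

lemma integrable_mul_of_hasCompactSupport {g φ : ℝ → ℝ} (hg : LocallyIntegrable g volume)
    (hφ : Continuous φ) (hc : HasCompactSupport φ) : Integrable (fun x => g x * φ x) := by
  have := hg.integrable_smul_left_of_hasCompactSupport hφ hc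
  refine this.congr (ae_of_all _ fun x => ?_)
  simp [mul_comm]

lemma locallyIntegrable_mul_continuous {g χ : ℝ → ℝ} (hg : LocallyIntegrable g volume)
    (hχ : Continuous χ) : LocallyIntegrable (fun x => χ x * g x) volume := by
  rw [← locallyIntegrableOn_univ] at hg ⊢
  exact hg.continuousOn_mul hχ.continuousOn isOpen_univ.isLocallyClosed

lemma hasCompactSupport_iteratedDeriv {φ : ℝ → ℝ} (hc : HasCompactSupport φ) (j : ℕ) :
    HasCompactSupport (iteratedDeriv j φ) := by
  induction j with
  | zero => simpa using hc
  | succ n ih => rw [iteratedDeriv_succ]; exact ih.deriv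

lemma contDiff_iteratedDeriv {φ : ℝ → ℝ} (h : ContDiff ℝ ((⊤ : ℕ∞) : WithTop ℕ∞) φ) (j : ℕ) :
    ContDiff ℝ ((⊤ : ℕ∞) : WithTop ℕ∞) (iteratedDeriv j φ) := by
  induction j with
  | zero => simpa using h
  | succ n ih =>
    rw [iteratedDeriv_succ]
    exact (contDiff_infty_iff_deriv.1 ih).2

lemma contDiff_deriv {φ : ℝ → ℝ} (h : ContDiff ℝ ((⊤ : ℕ∞) : WithTop ℕ∞) φ) :
    ContDiff ℝ ((⊤ : ℕ∞) : WithTop ℕ∞) (deriv φ) := (contDiff_infty_iff_deriv.1 h).2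

namespace IsWeakDeriv

variable {j : ℕ} {u v g h : ℝ → ℝ}

lemma ae_unique (h₁ : IsWeakDeriv j u g) (h₂ : IsWeakDeriv j u h) : g =ᵐ[volume] h := by
  refine ae_eq_of_integral_contDiff_smul_eq h₁.2.1 h₂.2.1 fun φ hφ hc => ?_
  have e := (h₁.2.2 φ hφ hc).symm.trans (h₂.2.2 φ hφ hc)
  have := mul_left_cancel₀ (pow_ne_zero j (by norm_num : (-1 : ℝ) ≠ 0)) e
  simpa [mul_comm] using this

lemma congr_right (h₁ : IsWeakDeriv j u g) (e : g =ᵐ[volume] h) : IsWeakDeriv j u h := by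
  refine ⟨h₁.1, h₁.2.1.congr e, fun φ hφ hc => ?_⟩
  rw [h₁.2.2 φ hφ hc]
  congr 1
  exact integral_congr_ae (e.mul (ae_eq_refl φ))

/-- Uniqueness makes the arbitrary choice inside `weakDeriv` harmless: any explicit weak derivative
may replace it under an integral. -/
lemma weakDeriv_ae_eq (h : IsWeakDeriv j u g) : weakDeriv j u =ᵐ[volume] g := by
  have hex : ∃ g, IsWeakDeriv j u g := ⟨g, h⟩
  rw [weakDeriv, dif_pos hex]
  exact hex.choose_spec.ae_unique h

protected lemma zero (hu : LocallyIntegrable u volume) : IsWeakDeriv 0 u u :=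
  ⟨hu, hu, fun φ _ _ => by simp⟩

protected lemma add (h₁ : IsWeakDeriv j u g) (h₂ : IsWeakDeriv j v h) :
    IsWeakDeriv j (fun x => u x + v x) (fun x => g x + h x) := by
  refine ⟨h₁.1.add h₂.1, h₁.2.1.add h₂.2.1, fun φ hφ hc => ?_⟩
  have c := (contDiff_iteratedDeriv hφ j).continuous
  have s := hasCompactSupport_iteratedDeriv hc j
  simp only [add_mul]
  rw [integral_add (integrable_mul_of_hasCompactSupport h₁.1 c s)
      (integrable_mul_of_hasCompactSupport h₂.1 c s),
    integral_add (integrable_mul_of_hasCompactSupport h₁.2.1 hφ.continuous hc)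
      (integrable_mul_of_hasCompactSupport h₂.2.1 hφ.continuous hc),
    h₁.2.2 φ hφ hc, h₂.2.2 φ hφ hc, mul_add]

protected lemma const_mul (h₁ : IsWeakDeriv j u g) (c : ℝ) :
    IsWeakDeriv j (fun x => c * u x) (fun x => c * g x) := by
  refine ⟨locallyIntegrable_mul_continuous h₁.1 continuous_const,
    locallyIntegrable_mul_continuous h₁.2.1 continuous_const, fun φ hφ hc => ?_⟩
  simp only [mul_assoc, integral_const_mul]
  rw [h₁.2.2 φ hφ hc]; ring

protected lemma sub (h₁ : IsWeakDeriv j u g) (h₂ : IsWeakDeriv j v h) :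
    IsWeakDeriv j (fun x => u x - v x) (fun x => g x - h x) := by
  convert h₁.add (h₂.const_mul (-1)) using 2 <;> ring

/-- The defining identity of a first order weak derivative. -/
lemma integral_mul_deriv (h₁ : IsWeakDeriv 1 u g) {φ : ℝ → ℝ}
    (hφ : ContDiff ℝ ((⊤ : ℕ∞) : WithTop ℕ∞) φ) (hc : HasCompactSupport φ) :
    ∫ x, u x * deriv φ x = -∫ x, g x * φ x := by
  simpa using h₁.2.2 φ hφ hc

lemma of_integral_mul_deriv (hu : LocallyIntegrable u volume) (hg : LocallyIntegrable g volume)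
    (h : ∀ φ : ℝ → ℝ, ContDiff ℝ ((⊤ : ℕ∞) : WithTop ℕ∞) φ → HasCompactSupport φ →
      ∫ x, u x * deriv φ x = -∫ x, g x * φ x) : IsWeakDeriv 1 u g :=
  ⟨hu, hg, fun φ hφ hc => by simpa using h φ hφ hc⟩

/-- Consecutive weak derivatives of `u` are weak derivatives of each other. -/
lemma one_of_succ (h₁ : IsWeakDeriv j u g) (h₂ : IsWeakDeriv (j + 1) u h) :
    IsWeakDeriv 1 g h := by
  refine of_integral_mul_deriv h₁.2.1 h₂.2.1 fun φ hφ hc => ?_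
  have e₁ := h₁.2.2 (deriv φ) (contDiff_deriv hφ) hc.deriv
  have e₂ := h₂.2.2 φ hφ hc
  rw [iteratedDeriv_succ', e₁, pow_succ, mul_assoc] at e₂
  simpa using mul_left_cancel₀ (pow_ne_zero j (by norm_num : (-1 : ℝ) ≠ 0)) e₂

lemma succ (h₁ : IsWeakDeriv 1 u v) (h₂ : IsWeakDeriv j v h) : IsWeakDeriv (j + 1) u h := by
  refine ⟨h₁.1, h₂.2.1, fun φ hφ hc => ?_⟩
  rw [iteratedDeriv_succ, h₁.integral_mul_deriv (contDiff_iteratedDeriv hφ j)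
    (hasCompactSupport_iteratedDeriv hc j), h₂.2.2 φ hφ hc, pow_succ]
  ring

/-- The product rule for a smooth factor. -/
lemma smooth_mul (h₁ : IsWeakDeriv 1 u g) {χ : ℝ → ℝ}
    (hχ : ContDiff ℝ ((⊤ : ℕ∞) : WithTop ℕ∞) χ) :
    IsWeakDeriv 1 (fun x => χ x * u x) (fun x => χ x * g x + deriv χ x * u x) := by
  have hχ' := contDiff_deriv hχ
  refine of_integral_mul_deriv (locallyIntegrable_mul_continuous h₁.1 hχ.continuous)
    ((locallyIntegrable_mul_continuous h₁.2.1 hχ.continuous).add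
      (locallyIntegrable_mul_continuous h₁.1 hχ'.continuous)) fun φ hφ hc => ?_
  have e := h₁.integral_mul_deriv (hχ.mul hφ) hc.mul_left
  have d : deriv (fun x => χ x * φ x) = fun x => deriv χ x * φ x + χ x * deriv φ x := by
    ext x
    exact deriv_mul ((hχ.differentiable (by simp)) x) ((hφ.differentiable (by simp)) x)
  have i₁ : Integrable (fun x => u x * (deriv χ x * φ x)) :=
    integrable_mul_of_hasCompactSupport h₁.1 (hχ'.continuous.mul hφ.continuous) hc.mul_left
  have i₂ : Integrable (fun x => u x * (χ x * deriv φ x)) :=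
    integrable_mul_of_hasCompactSupport h₁.1
      (hχ.continuous.mul (contDiff_deriv hφ).continuous) hc.deriv.mul_left
  have i₃ : Integrable (fun x => g x * (χ x * φ x)) :=
    integrable_mul_of_hasCompactSupport h₁.2.1 (hχ.continuous.mul hφ.continuous) hc.mul_left
  rw [d] at e
  simp only [mul_add] at e
  rw [integral_add i₁ i₂] at e
  have r₁ : ∫ x, χ x * u x * deriv φ x = ∫ x, u x * (χ x * deriv φ x) := by
    congr 1; ext x; ring
  have r₂ : ∫ x, (χ x * g x + deriv χ x * u x) * φ x
      = (∫ x, g x * (χ x * φ x)) + ∫ x, u x * (deriv χ x * φ x) := by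
    rw [← integral_add i₃ i₁]; congr 1; ext x; ring
  rw [r₁, r₂]; linarith

lemma of_contDiff (hu : ContDiff ℝ ((⊤ : ℕ∞) : WithTop ℕ∞) u) (j : ℕ) :
    IsWeakDeriv j u (iteratedDeriv j u) := by
  induction j generalizing u with
  | zero => simpa using IsWeakDeriv.zero hu.continuous.locallyIntegrable
  | succ n ih =>
    rw [iteratedDeriv_succ']
    refine IsWeakDeriv.succ ?_ (ih (contDiff_deriv hu))
    have hu' := contDiff_deriv hu
    refine of_integral_mul_deriv hu.continuous.locallyIntegrable
      hu'.continuous.locallyIntegrable fun φ hφ hc => ?_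
    have hφ' := contDiff_deriv hφ
    exact integral_mul_deriv_eq_deriv_mul_of_integrable
      (fun x _ => (hu.differentiable (by simp) x).hasDerivAt)
      (fun x _ => (hφ.differentiable (by simp) x).hasDerivAt)
      (integrable_mul_of_hasCompactSupport hu.continuous.locallyIntegrable hφ'.continuous hc.deriv)
      (integrable_mul_of_hasCompactSupport hu'.continuous.locallyIntegrable hφ.continuous hc)
      (integrable_mul_of_hasCompactSupport hu.continuous.locallyIntegrable hφ.continuous hc)

end IsWeakDeriv

end WeakDerivative

/-! ### L² increments and the fundamental theorem of calculus for weak derivatives -/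

section Increments

/-- The squared `L²` norm of `h`. -/
def sqNorm (h : ℝ → ℝ) : ℝ≥0∞ := ∫⁻ x, ‖h x‖ₑ ^ 2

/-- The squared `L²` norm of the increment `h(· + r) - h`. -/
def sqIncr (h : ℝ → ℝ) (r : ℝ) : ℝ≥0∞ := ∫⁻ x, ‖h (x + r) - h x‖ₑ ^ 2

/-- Cauchy–Schwarz against the constant one. -/
lemma sq_lintegral_le {α : Type*} [MeasurableSpace α] {μ : Measure α} {f : α → ℝ≥0∞}
    (hf : AEMeasurable f μ) : (∫⁻ x, f x ∂μ) ^ 2 ≤ μ univ * ∫⁻ x, f x ^ 2 ∂μ := by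
  have h := ENNReal.lintegral_mul_le_Lp_mul_Lq μ (p := 2) (q := 2) ⟨by norm_num, by norm_num,
    by norm_num⟩ (aemeasurable_const (b := 1)) hf
  simp only [Pi.mul_apply, one_mul, ENNReal.rpow_ofNat, one_pow, lintegral_const] at h
  calc (∫⁻ x, f x ∂μ) ^ 2
      ≤ (μ univ ^ (1 / 2 : ℝ) * (∫⁻ x, f x ^ 2 ∂μ) ^ (1 / 2 : ℝ)) ^ 2 := by gcongr
    _ = _ := by
      rw [mul_pow, ← ENNReal.rpow_natCast, ← ENNReal.rpow_natCast, ← ENNReal.rpow_mul,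
        ← ENNReal.rpow_mul]
      norm_num

lemma enorm_add_sq_le (a b : ℝ) : ‖a + b‖ₑ ^ 2 ≤ 2 * ‖a‖ₑ ^ 2 + 2 * ‖b‖ₑ ^ 2 := by
  simp only [Real.enorm_eq_ofReal_abs, ← ENNReal.ofReal_pow (abs_nonneg _), sq_abs]
  rw [← ENNReal.ofReal_ofNat 2, ← ENNReal.ofReal_mul (by norm_num),
    ← ENNReal.ofReal_mul (by norm_num), ← ENNReal.ofReal_add (by positivity) (by positivity)]
  exact ENNReal.ofReal_le_ofReal (by nlinarith [sq_nonneg (a - b)])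

lemma enorm_sub_sq_le (a b : ℝ) : ‖a - b‖ₑ ^ 2 ≤ 2 * ‖a‖ₑ ^ 2 + 2 * ‖b‖ₑ ^ 2 := by
  simpa [sub_eq_add_neg] using enorm_add_sq_le a (-b)

variable {h g : ℝ → ℝ}

lemma sqNorm_comp_add (h : ℝ → ℝ) (r : ℝ) : ∫⁻ x, ‖h (x + r)‖ₑ ^ 2 = sqNorm h :=
  lintegral_add_right_eq_self (fun x => ‖h x‖ₑ ^ 2) r

lemma aestronglyMeasurable_comp_add (hm : AEStronglyMeasurable h volume) (r : ℝ) :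
    AEStronglyMeasurable (fun x => h (x + r)) volume :=
  hm.comp_quasiMeasurePreserving (measurePreserving_add_right volume r).quasiMeasurePreserving

lemma aestronglyMeasurable_prod_add (ν : Measure ℝ) [SFinite ν]
    (hm : AEStronglyMeasurable h volume) :
    AEStronglyMeasurable (fun p : ℝ × ℝ => h (p.1 + p.2)) ((volume : Measure ℝ).prod ν) :=
  hm.comp_quasiMeasurePreserving
    (Measure.quasiMeasurePreserving_fst.comp
      (measurePreserving_add_prod volume ν).quasiMeasurePreserving)

lemma sqIncr_le_sqNorm (hm : AEStronglyMeasurable h volume) (r : ℝ) :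
    sqIncr h r ≤ 4 * sqNorm h := by
  calc sqIncr h r ≤ ∫⁻ x, (2 * ‖h (x + r)‖ₑ ^ 2 + 2 * ‖h x‖ₑ ^ 2) :=
        lintegral_mono fun x => enorm_sub_sq_le _ _
    _ = 2 * sqNorm h + 2 * sqNorm h := by
        rw [lintegral_add_right' _ ((hm.enorm.pow_const 2).const_mul 2),
          lintegral_const_mul' _ _ (by simp), lintegral_const_mul' _ _ (by simp),
          sqNorm_comp_add, sqNorm]
    _ = 4 * sqNorm h := by rw [← add_mul]; norm_num

/-- A primitive of the difference of two translates of a test function is a test function. -/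
lemma contDiff_intervalIntegral_comp_sub {φ : ℝ → ℝ}
    (hφ : ContDiff ℝ ((⊤ : ℕ∞) : WithTop ℕ∞) φ) (r : ℝ) :
    ContDiff ℝ ((⊤ : ℕ∞) : WithTop ℕ∞) (fun x => ∫ t in (0 : ℝ)..r, φ (x - t)) ∧
      deriv (fun x => ∫ t in (0 : ℝ)..r, φ (x - t)) = fun x => φ x - φ (x - r) := by
  have hd : ∀ x, HasDerivAt (fun x => ∫ t in (0 : ℝ)..r, φ (x - t)) (φ x - φ (x - r)) x := by
    intro x
    have e : (fun x => ∫ t in (0 : ℝ)..r, φ (x - t))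
        = fun x => (∫ t in (0 : ℝ)..x, φ t) - ∫ t in (0 : ℝ)..(x - r), φ t := by
      ext x
      rw [intervalIntegral.integral_comp_sub_left, sub_zero,
        intervalIntegral.integral_interval_sub_left] <;>
      exact hφ.continuous.intervalIntegrable _ _
    rw [e]
    have h₁ : ∀ y, HasDerivAt (fun x => ∫ t in (0 : ℝ)..x, φ t) (φ y) y := fun y =>
      hφ.continuous.integral_hasStrictDerivAt 0 y |>.hasDerivAt
    exact (h₁ x).sub ((h₁ (x - r)).comp_sub_const x r)
  have e : deriv (fun x => ∫ t in (0 : ℝ)..r, φ (x - t)) = fun x => φ x - φ (x - r) :=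
    funext fun x => (hd x).deriv
  refine ⟨contDiff_infty_iff_deriv.2 ⟨fun x => (hd x).differentiableAt, ?_⟩, e⟩
  rw [e]
  fun_prop

lemma hasCompactSupport_subset_closedBall {φ : ℝ → ℝ} (hc : HasCompactSupport φ) :
    ∃ R : ℝ, 0 ≤ R ∧ ∀ x, R < |x| → φ x = 0 := by
  obtain ⟨R, hR⟩ := hc.isBounded.subset_closedBall 0
  refine ⟨max R 0, le_max_right _ _, fun x hx => ?_⟩
  by_contra hne
  have := hR (subset_tsupport φ hne)
  rw [Metric.mem_closedBall, dist_zero_right, Real.norm_eq_abs] at this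
  exact absurd hx (not_lt.2 (this.trans (le_max_left _ _)))

lemma abs_le_of_mem_uIoc_zero {r t : ℝ} (ht : t ∈ uIoc 0 r) : |t| ≤ |r| := by
  rcases mem_uIoc.1 ht with h | h
  · rw [abs_of_pos h.1, abs_of_pos (h.1.trans_le h.2)]; exact h.2
  · rw [abs_of_nonpos h.2, abs_of_neg (h.1.trans_le h.2)]; linarith

/-- Fubini and the translation `x ↦ x + t`: integrating translates over an interval is moved from
the test function to `g`. -/
lemma integral_mul_integral_comp_sub (hg : LocallyIntegrable g volume) {φ : ℝ → ℝ}
    (hφ : Continuous φ) (hc : HasCompactSupport φ) (r : ℝ) :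
    ∫ x, g x * ∫ t in uIoc 0 r, φ (x - t) = ∫ x, (∫ t in uIoc 0 r, g (x + t)) * φ x := by
  set ν : Measure ℝ := volume.restrict (uIoc 0 r) with hν
  have : IsFiniteMeasure ν := ⟨by simp [hν, uIoc]⟩
  obtain ⟨R, hR0, hR⟩ := hasCompactSupport_subset_closedBall hc
  obtain ⟨M, hM⟩ := hc.exists_bound_of_continuous hφ
  have i₂ : Integrable (fun p : ℝ × ℝ => g p.1 * φ (p.1 - p.2)) ((volume : Measure ℝ).prod ν) := by
    -- For `|t| ≤ |r|` the factor `φ (x - t)` vanishes when `|x| > R + |r|`, so `g` may be truncated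
    -- to an integrable function.
    set S := Metric.closedBall (0 : ℝ) (R + |r|)
    have hS : Integrable (S.indicator g) :=
      (hg.integrableOn_isCompact (isCompact_closedBall _ _)).integrable_indicator
        Metric.isClosed_closedBall.measurableSet
    have h₁ : Integrable (fun p : ℝ × ℝ => φ (p.1 - p.2) * (S.indicator g p.1))
        ((volume : Measure ℝ).prod ν) :=
      (hS.comp_fst ν).bdd_mul (by fun_prop) (ae_of_all _ fun p => hM (p.1 - p.2))
    refine h₁.congr ?_
    have hae : ∀ᵐ p ∂((volume : Measure ℝ).prod ν), p.2 ∈ uIoc 0 r :=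
      Measure.quasiMeasurePreserving_snd.ae (ae_restrict_mem measurableSet_uIoc)
    filter_upwards [hae] with p hp
    by_cases hpS : p.1 ∈ S
    · rw [indicator_of_mem hpS, mul_comm]
    · rw [indicator_of_notMem hpS, hR]
      · ring
      · have h₂ : R + |r| < |p.1| := by simpa [S] using hpS
        have h₃ := abs_le_of_mem_uIoc_zero hp
        have h₄ := abs_sub_abs_le_abs_sub p.1 p.2
        linarith
  have i₁ : Integrable (fun p : ℝ × ℝ => g (p.1 + p.2) * φ p.1) ((volume : Measure ℝ).prod ν) := by
    have := (measurePreserving_add_prod (volume : Measure ℝ) ν).integrable_comp_of_integrable i₂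
    simpa [Function.comp_def] using this
  calc ∫ x, g x * ∫ t, φ (x - t) ∂ν
      = ∫ x, ∫ t, g x * φ (x - t) ∂ν := by simp_rw [integral_const_mul]
    _ = ∫ t, (∫ x, g x * φ (x - t)) ∂ν := integral_integral_swap i₂
    _ = ∫ t, (∫ x, g (x + t) * φ x) ∂ν := by
        congr 1; ext t
        rw [← integral_add_right_eq_self _ t]; simp
    _ = ∫ x, ∫ t, g (x + t) * φ x ∂ν := (integral_integral_swap i₁).symm
    _ = _ := by simp_rw [integral_mul_const]

/-- A function with a locally integrable weak derivative has the increments given by the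
fundamental theorem of calculus. -/
lemma IsWeakDeriv.increment_ae_eq (hw : IsWeakDeriv 1 h g) (r : ℝ) :
    ∀ᵐ x, h (x + r) - h x = ∫ t in (0 : ℝ)..r, g (x + t) := by
  have hl : LocallyIntegrable (fun x => h (x + r)) volume := by
    have := locallyIntegrable_map_homeomorph (f := h) (μ := volume) (Homeomorph.addRight r)
    rw [Homeomorph.coe_addRight, map_add_right_eq_self] at this
    exact this.1 hw.1
  have hl' : LocallyIntegrable (fun x => ∫ t in (0 : ℝ)..r, g (x + t)) volume := by
    have hi : ∀ a b, IntervalIntegrable g volume a b := fun a b =>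
      (hw.2.1.integrableOn_isCompact isCompact_uIcc).intervalIntegrable
    have hP := intervalIntegral.continuous_primitive hi 0
    have e : (fun x => ∫ t in (0 : ℝ)..r, g (x + t))
        = fun x => (∫ t in (0 : ℝ)..(x + r), g t) - ∫ t in (0 : ℝ)..x, g t := by
      ext x
      rw [intervalIntegral.integral_comp_add_left, add_zero,
        intervalIntegral.integral_interval_sub_left (hi _ _) (hi _ _)]
    rw [e]
    exact Continuous.locallyIntegrable (by fun_prop)
  refine ae_eq_of_integral_contDiff_smul_eq (hl.sub hw.1) hl' fun φ hφ hc => ?_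
  -- The test function to use is the one whose derivative is `φ - φ (· - r)`; pairing `h` with that
  -- derivative produces the increment of `h` up to sign.
  obtain ⟨hψ, hψ'⟩ := contDiff_intervalIntegral_comp_sub hφ r
  have hψc : HasCompactSupport (fun x => ∫ t in (0 : ℝ)..r, φ (x - t)) := by
    obtain ⟨R, hR0, hR⟩ := hasCompactSupport_subset_closedBall hc
    refine HasCompactSupport.intro (isCompact_closedBall 0 (R + |r|)) fun x hx => ?_
    have hx' : R + |r| < |x| := by simpa using hx
    refine intervalIntegral.integral_zero_ae (ae_of_all _ fun t ht => hR _ ?_)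
    have h₃ := abs_le_of_mem_uIoc_zero ht
    have h₄ := abs_sub_abs_le_abs_sub x t
    linarith
  have key := hw.integral_mul_deriv hψ hψc
  rw [hψ'] at key
  have i₁ := integrable_mul_of_hasCompactSupport hw.1 hφ.continuous hc
  have i₂ : Integrable (fun x => h x * φ (x - r)) :=
    integrable_mul_of_hasCompactSupport hw.1 (by fun_prop)
      (hc.comp_homeomorph (Homeomorph.subRight r))
  have i₃ := integrable_mul_of_hasCompactSupport hl hφ.continuous hc
  have e₁ : ∫ x, h x * φ (x - r) = ∫ x, h (x + r) * φ x := by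
    rw [← integral_add_right_eq_self _ r]; simp
  simp only [mul_sub] at key
  rw [integral_sub i₁ i₂, e₁] at key
  have e₂ : ∫ x, φ x • (h (x + r) - h x) = (∫ x, h (x + r) * φ x) - ∫ x, h x * φ x := by
    rw [← integral_sub i₃ i₁]; congr 1; ext x; simp only [smul_eq_mul]; ring
  have e₃ := integral_mul_integral_comp_sub hw.2.1 hφ.continuous hc r
  simp only [intervalIntegral.intervalIntegral_eq_integral_uIoc, smul_eq_mul] at key ⊢
  rw [show (fun x => φ x * (h (x + r) - h x)) = fun x => φ x • (h (x + r) - h x) from rfl, e₂]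
  -- The orientation of the interval integral is a common factor, so both signs of `r` are treated
  -- at once.
  set c : ℝ := if (0 : ℝ) ≤ r then 1 else -1
  have e₄ : ∫ x, g x * (c * ∫ t in uIoc 0 r, φ (x - t))
      = c * ∫ x, g x * ∫ t in uIoc 0 r, φ (x - t) := by
    rw [← integral_const_mul]; congr 1; ext x; ring
  have e₅ : ∫ x, φ x * (c * ∫ t in uIoc 0 r, g (x + t))
      = c * ∫ x, (∫ t in uIoc 0 r, g (x + t)) * φ x := by
    rw [← integral_const_mul]; congr 1; ext x; ring
  rw [e₄, e₃] at key
  rw [e₅]; linarith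

/-- The increment is an integral of `g` over length `|r|`. Cauchy–Schwarz gives one factor `|r|`;
Fubini and translation invariance give the other. -/
lemma IsWeakDeriv.sqIncr_le (hw : IsWeakDeriv 1 h g) (r : ℝ) :
    sqIncr h r ≤ ENNReal.ofReal |r| ^ 2 * sqNorm g := by
  set ν : Measure ℝ := volume.restrict (uIoc 0 r) with hν
  have hνu : ν univ = ENNReal.ofReal |r| := by simp [hν, uIoc, max_sub_min_eq_abs]
  have hgm := hw.2.1.aestronglyMeasurable
  have hm : ∀ x, AEMeasurable (fun t => ‖g (x + t)‖ₑ) ν := fun x => by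
    simp_rw [add_comm x]
    exact (aestronglyMeasurable_comp_add hgm x).enorm.mono_measure Measure.restrict_le_self
  calc sqIncr h r ≤ ∫⁻ x, ENNReal.ofReal |r| * ∫⁻ t, ‖g (x + t)‖ₑ ^ 2 ∂ν := by
        refine lintegral_mono_ae ?_
        filter_upwards [hw.increment_ae_eq r] with x hx
        rw [hx, ← hνu]
        refine le_trans ?_ (sq_lintegral_le (hm x))
        gcongr
        rw [← ofReal_norm, intervalIntegral.norm_intervalIntegral_eq, ofReal_norm]
        exact enorm_integral_le_lintegral_enorm _
    _ = ENNReal.ofReal |r| * ∫⁻ x, ∫⁻ t, ‖g (x + t)‖ₑ ^ 2 ∂ν := by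
        rw [lintegral_const_mul' _ _ (by simp)]
    _ = ENNReal.ofReal |r| * ∫⁻ t, (∫⁻ x, ‖g (x + t)‖ₑ ^ 2) ∂ν := by
        rw [lintegral_lintegral_swap]
        exact (aestronglyMeasurable_prod_add ν hgm).enorm.pow_const 2
    _ = _ := by
        simp_rw [sqNorm_comp_add]
        rw [lintegral_const, hνu]; ring

end Increments

/-! ### The Gagliardo seminorm through increments, and interpolation -/

section Seminorm

/-- The singular kernel `|r|^{-(1 + 2s)}`. -/
def fracKernel (s r : ℝ) : ℝ≥0∞ := ENNReal.ofReal ((|r| ^ (1 + 2 * s))⁻¹)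

/-- The squared Gagliardo seminorm on `ℝ`, expressed through increments. -/
def sqSemi (s : ℝ) (h : ℝ → ℝ) : ℝ≥0∞ := ∫⁻ r, fracKernel s r * sqIncr h r

/-- The increments of `h` of length at most one, measured in `L²`. -/
def nearIncr (h : ℝ → ℝ) : ℝ≥0∞ := ∫⁻ r in Ioo (-1 : ℝ) 1, sqIncr h r

variable {s : ℝ} {h g u : ℝ → ℝ}

lemma measurable_fracKernel (s : ℝ) : Measurable (fracKernel s) := by
  unfold fracKernel; fun_prop

lemma fracKernel_ne_top (s r : ℝ) : fracKernel s r ≠ ∞ := ENNReal.ofReal_ne_top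

lemma one_le_fracKernel (hs : 0 < s) {r : ℝ} (h0 : r ≠ 0) (h1 : |r| ≤ 1) :
    1 ≤ fracKernel s r := by
  rw [fracKernel, ENNReal.one_le_ofReal]
  exact (one_le_inv₀ (Real.rpow_pos_of_pos (abs_pos.2 h0) _)).2
    (Real.rpow_le_one (abs_nonneg _) h1 (by linarith))

/-- Near zero the integrand is at most `r ^ (1 - 2 * s)`, integrable as `s < 1`; at infinity it is
at most `r ^ (-(1 + 2 * s))`, integrable as `s > 0`. -/
lemma lintegral_fracKernel_mul_min_lt_top (hs0 : 0 < s) (hs1 : s < 1) :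
    ∫⁻ r, fracKernel s r * ENNReal.ofReal (min 1 (r ^ 2)) < ∞ := by
  set F : ℝ → ℝ≥0∞ := fun r => fracKernel s r * ENNReal.ofReal (min 1 (r ^ 2)) with hF
  have hFm : Measurable F := (measurable_fracKernel s).mul (by fun_prop)
  have hhalf : ∫⁻ r in Ioi 0, F r < ∞ := by
    have h₁ : ∫⁻ r in Ioo 0 2, F r < ∞ := by
      have i : IntegrableOn (fun r : ℝ => r ^ (1 - 2 * s)) (Ioo 0 2) :=
        (intervalIntegral.integrableOn_Ioo_rpow_iff (by norm_num)).2 (by linarith)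
      refine (setLIntegral_mono' measurableSet_Ioo fun r hr => ?_).trans_lt i.lintegral_lt_top
      rw [hF]
      simp only [fracKernel]
      rw [← ENNReal.ofReal_mul (by positivity)]
      refine ENNReal.ofReal_le_ofReal ?_
      rw [abs_of_pos hr.1, ← Real.rpow_neg hr.1.le]
      calc r ^ (-(1 + 2 * s)) * min 1 (r ^ 2) ≤ r ^ (-(1 + 2 * s)) * r ^ (2 : ℝ) := by
            have := Real.rpow_nonneg hr.1.le (-(1 + 2 * s))
            rw [Real.rpow_ofNat]
            gcongr
            exact min_le_right _ _
        _ = r ^ (1 - 2 * s) := by rw [← Real.rpow_add hr.1]; ring_nf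
    have h₂ : ∫⁻ r in Ioi 1, F r < ∞ := by
      have i : IntegrableOn (fun r : ℝ => r ^ (-(1 + 2 * s))) (Ioi 1) :=
        integrableOn_Ioi_rpow_of_lt (by linarith) one_pos
      refine (setLIntegral_mono' measurableSet_Ioi fun r hr => ?_).trans_lt i.lintegral_lt_top
      have hr0 : (0 : ℝ) < r := one_pos.trans hr
      rw [hF]
      simp only [fracKernel]
      rw [← ENNReal.ofReal_mul (by positivity)]
      refine ENNReal.ofReal_le_ofReal ?_
      rw [abs_of_pos hr0, ← Real.rpow_neg hr0.le]
      exact mul_le_of_le_one_right (Real.rpow_nonneg hr0.le _) (min_le_left _ _)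
    have hsub : Ioi (0 : ℝ) ⊆ Ioo 0 2 ∪ Ioi 1 := fun r hr => by
      rcases lt_or_ge r 2 with h | h
      · exact Or.inl ⟨hr, h⟩
      · exact Or.inr (lt_of_lt_of_le (by norm_num) h)
    exact ((lintegral_mono_set hsub).trans (lintegral_union_le _ _ _)).trans_lt
      (ENNReal.add_lt_top.2 ⟨h₁, h₂⟩)
  set F₁ := (Ioi (0 : ℝ)).indicator F
  have hF₁ : ∫⁻ r, F₁ r < ∞ := by rwa [lintegral_indicator measurableSet_Ioi]
  have hF₁m : Measurable F₁ := hFm.indicator measurableSet_Ioi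
  -- `F` is even and vanishes at zero, so the half-line bound controls both halves.
  have hle : ∀ r, F r ≤ F₁ r + F₁ (0 - r) := by
    intro r
    rcases lt_trichotomy r 0 with h | h | h
    · have : F₁ (0 - r) = F r := by
        have h' : 0 - r ∈ Ioi (0 : ℝ) := by simpa using h
        rw [show F₁ (0 - r) = F (0 - r) from indicator_of_mem h' F, hF]; simp [fracKernel]
      rw [this]; exact le_add_self
    · subst h; simp [hF]
    · rw [show F₁ r = F r from indicator_of_mem h F]; exact le_self_add
  calc ∫⁻ r, F r ≤ ∫⁻ r, (F₁ r + F₁ (0 - r)) := lintegral_mono hle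
    _ = (∫⁻ r, F₁ r) + ∫⁻ r, F₁ r := by
      rw [lintegral_add_left hF₁m, lintegral_sub_left_eq_self F₁ 0]
    _ < ∞ := ENNReal.add_lt_top.2 ⟨hF₁, hF₁⟩

lemma aemeasurable_sqIncr_integrand (hm : AEStronglyMeasurable h volume) :
    AEMeasurable (fun p : ℝ × ℝ => ‖h (p.1 + p.2) - h p.2‖ₑ ^ 2)
      ((volume : Measure ℝ).prod volume) := by
  refine AEMeasurable.pow_const (AEStronglyMeasurable.enorm ?_) 2
  exact (aestronglyMeasurable_prod_add volume hm).sub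
    (hm.comp_quasiMeasurePreserving Measure.quasiMeasurePreserving_snd)

lemma sqIncr_eq (h : ℝ → ℝ) : sqIncr h = fun r => ∫⁻ x, ‖h (r + x) - h x‖ₑ ^ 2 := by
  ext r; simp only [sqIncr, add_comm]

lemma aemeasurable_sqIncr (hm : AEStronglyMeasurable h volume) : AEMeasurable (sqIncr h) := by
  rw [sqIncr_eq]
  exact (aemeasurable_sqIncr_integrand hm).lintegral_prod_right'

lemma aemeasurable_gagliardo_integrand (hm : AEStronglyMeasurable h volume) :
    AEMeasurable (fun p : ℝ × ℝ => ENNReal.ofReal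
      (1 * (|h p.1 - h p.2| ^ 2 / |p.1 - p.2| ^ (1 + 2 * s))))
      ((volume : Measure ℝ).prod volume) := by
  have m₁ : AEStronglyMeasurable (fun p : ℝ × ℝ => h p.1) ((volume : Measure ℝ).prod volume) :=
    hm.comp_quasiMeasurePreserving Measure.quasiMeasurePreserving_fst
  have m₂ : AEStronglyMeasurable (fun p : ℝ × ℝ => h p.2) ((volume : Measure ℝ).prod volume) :=
    hm.comp_quasiMeasurePreserving Measure.quasiMeasurePreserving_snd
  have m₃ : AEMeasurable (fun p : ℝ × ℝ => |h p.1 - h p.2|) ((volume : Measure ℝ).prod volume) :=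
    (m₁.sub m₂).norm.aemeasurable
  refine AEMeasurable.ennreal_ofReal (((m₃.pow_const 2).div ?_).const_mul 1)
  exact Measurable.aemeasurable (by fun_prop)

/-- The shear `(r, x) ↦ (x + r, x)` preserves measure and turns the double integral into an integral
over increments `r`. -/
lemma gagliardo_one_univ (hm : AEStronglyMeasurable h volume) :
    gagliardo (fun _ => 1) s univ h = sqSemi s h := by
  set T : ℝ × ℝ → ℝ × ℝ := fun z => (z.1 + z.2, z.2)
  have hT : MeasurePreserving T ((volume : Measure ℝ).prod volume) (volume.prod volume) :=
    measurePreserving_add_prod volume volume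
  have hF := aemeasurable_gagliardo_integrand (s := s) hm
  have hG : AEMeasurable (fun p : ℝ × ℝ => fracKernel s p.1 * ‖h (p.1 + p.2) - h p.2‖ₑ ^ 2)
      ((volume : Measure ℝ).prod volume) :=
    ((measurable_fracKernel s).comp measurable_fst).aemeasurable.mul
      (aemeasurable_sqIncr_integrand hm)
  rw [gagliardo, univ_prod_univ, Measure.restrict_univ, Measure.volume_eq_prod]
  rw [← hT.map_eq] at hF ⊢
  rw [lintegral_map' hF hT.measurable.aemeasurable]
  calc _ = ∫⁻ p, fracKernel s p.1 * ‖h (p.1 + p.2) - h p.2‖ₑ ^ 2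
        ∂((volume : Measure ℝ).prod volume) := by
        congr 1; ext p
        simp only [T, add_sub_cancel_right, one_mul]
        rw [Real.enorm_eq_ofReal_abs, ← ENNReal.ofReal_pow (abs_nonneg _), fracKernel,
          ← ENNReal.ofReal_mul (by positivity), div_eq_inv_mul]
    _ = sqSemi s h := by
        rw [lintegral_prod _ hG, sqSemi, sqIncr_eq]
        congr 1; ext r
        rw [lintegral_const_mul' _ _ (fracKernel_ne_top s r)]

lemma sqIncr_add_le (hm : AEStronglyMeasurable h volume) (r : ℝ) :
    sqIncr (fun x => g x + h x) r ≤ 2 * sqIncr g r + 2 * sqIncr h r := by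
  calc sqIncr (fun x => g x + h x) r
      ≤ ∫⁻ x, (2 * ‖g (x + r) - g x‖ₑ ^ 2 + 2 * ‖h (x + r) - h x‖ₑ ^ 2) := by
        refine lintegral_mono fun x => ?_
        convert enorm_add_sq_le (g (x + r) - g x) (h (x + r) - h x) using 3
        ring
    _ = _ := by
        have hm' : AEMeasurable (fun x => 2 * ‖h (x + r) - h x‖ₑ ^ 2) :=
          (((aestronglyMeasurable_comp_add hm r).sub hm).enorm.pow_const 2).const_mul 2
        rw [lintegral_add_right' _ hm',
          lintegral_const_mul' _ _ (by simp), lintegral_const_mul' _ _ (by simp), sqIncr, sqIncr]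

lemma sqNorm_add_le (hm : AEStronglyMeasurable h volume) :
    sqNorm (fun x => g x + h x) ≤ 2 * sqNorm g + 2 * sqNorm h := by
  calc sqNorm (fun x => g x + h x)
      ≤ ∫⁻ x, (2 * ‖g x‖ₑ ^ 2 + 2 * ‖h x‖ₑ ^ 2) := lintegral_mono fun x => enorm_add_sq_le _ _
    _ = _ := by
        rw [lintegral_add_right' _ ((hm.enorm.pow_const 2).const_mul 2),
          lintegral_const_mul' _ _ (by simp), lintegral_const_mul' _ _ (by simp), sqNorm, sqNorm]

lemma sqSemi_add_le (hm : AEStronglyMeasurable h volume) :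
    sqSemi s (fun x => g x + h x) ≤ 2 * sqSemi s g + 2 * sqSemi s h := by
  calc sqSemi s (fun x => g x + h x)
      ≤ ∫⁻ r, (2 * (fracKernel s r * sqIncr g r) + 2 * (fracKernel s r * sqIncr h r)) := by
        refine lintegral_mono fun r => ?_
        calc _ ≤ fracKernel s r * (2 * sqIncr g r + 2 * sqIncr h r) := by
              gcongr; exact sqIncr_add_le hm r
          _ = _ := by ring
    _ = _ := by
        have hm' : AEMeasurable (fun r => 2 * (fracKernel s r * sqIncr h r)) :=
          ((measurable_fracKernel s).aemeasurable.mul (aemeasurable_sqIncr hm)).const_mul 2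
        rw [lintegral_add_right' _ hm',
          lintegral_const_mul' _ _ (by simp), lintegral_const_mul' _ _ (by simp), sqSemi, sqSemi]

lemma nearIncr_le_sqSemi (hs : 0 < s) (h : ℝ → ℝ) : nearIncr h ≤ sqSemi s h := by
  refine le_trans (lintegral_mono_ae ?_) (lintegral_mono' Measure.restrict_le_self le_rfl)
  have h0 : ∀ᵐ r : ℝ ∂(volume.restrict (Ioo (-1) 1)), r ≠ 0 :=
    ae_restrict_of_ae (by simp [ae_iff])
  filter_upwards [h0, ae_restrict_mem measurableSet_Ioo] with r hr hr'
  exact le_mul_of_one_le_left' (one_le_fracKernel hs hr (abs_le.2 ⟨hr'.1.le, hr'.2.le⟩))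

/-- Control of short increments together with square integrability bounds the seminorm. -/
lemma sqSemi_lt_top_of_le (hs0 : 0 < s) (hs1 : s < 1) (hm : AEStronglyMeasurable h volume)
    (h2 : sqNorm h < ∞) {A : ℝ → ℝ≥0∞} (hA : ∫⁻ r, fracKernel s r * A r < ∞)
    {C : ℝ≥0∞} (hC : C ≠ ∞)
    (hle : ∀ r ∈ Ioo (-1 : ℝ) 1, sqIncr h r ≤ A r + C * ENNReal.ofReal |r| ^ 2) :
    sqSemi s h < ∞ := by
  -- One majorant for both ranges: `C` serves the quadratic term for `|r| < 1`, and `4 * sqNorm h`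
  -- the trivial bound for `|r| ≥ 1`.
  set B : ℝ → ℝ≥0∞ := fun r => (C + 4 * sqNorm h) *
    (fracKernel s r * ENNReal.ofReal (min 1 (r ^ 2))) with hB
  have hBm : Measurable B := ((measurable_fracKernel s).mul (by fun_prop)).const_mul _
  have hBf : ∫⁻ r, B r < ∞ := by
    have hc : C + 4 * sqNorm h < ∞ :=
      ENNReal.add_lt_top.2 ⟨hC.lt_top, ENNReal.mul_lt_top (by simp) h2⟩
    rw [hB, lintegral_const_mul' _ _ hc.ne]
    exact ENNReal.mul_lt_top hc (lintegral_fracKernel_mul_min_lt_top hs0 hs1)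
  have key : ∀ r, fracKernel s r * sqIncr h r ≤ fracKernel s r * A r + B r := by
    intro r
    have e : fracKernel s r * A r + B r = fracKernel s r *
        (A r + (C + 4 * sqNorm h) * ENNReal.ofReal (min 1 (r ^ 2))) := by rw [hB]; ring
    rw [e]
    gcongr
    by_cases hr : r ∈ Ioo (-1 : ℝ) 1
    · refine (hle r hr).trans ?_
      have : min 1 (r ^ 2) = |r| ^ 2 := by
        rw [sq_abs]; exact min_eq_right (by nlinarith [hr.1, hr.2])
      rw [this, ENNReal.ofReal_pow (abs_nonneg r)]
      gcongr
      exact le_self_add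
    · have : min 1 (r ^ 2) = 1 := by
        refine min_eq_left ?_
        rw [mem_Ioo, ← abs_lt, not_lt] at hr
        rw [← sq_abs]; nlinarith
      rw [this, ENNReal.ofReal_one, mul_one]
      exact (sqIncr_le_sqNorm hm r).trans (le_add_self.trans le_add_self)
  calc sqSemi s h ≤ ∫⁻ r, (fracKernel s r * A r + B r) := lintegral_mono key
    _ = (∫⁻ r, fracKernel s r * A r) + ∫⁻ r, B r := lintegral_add_right _ hBm
    _ < ∞ := ENNReal.add_lt_top.2 ⟨hA, hBf⟩

lemma IsWeakDeriv.nearIncr_lt_top (hw : IsWeakDeriv 1 h g) (hg : sqNorm g < ∞) :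
    nearIncr h < ∞ := by
  calc nearIncr h ≤ ∫⁻ _r in Ioo (-1 : ℝ) 1, sqNorm g := by
        refine setLIntegral_mono' measurableSet_Ioo fun r hr => (hw.sqIncr_le r).trans ?_
        refine mul_le_of_le_one_left' (pow_le_one₀ zero_le (ENNReal.ofReal_le_one.2 ?_))
        exact abs_le.2 ⟨hr.1.le, hr.2.le⟩
    _ < ∞ := by
        rw [setLIntegral_const]
        exact ENNReal.mul_lt_top hg (by simp)

lemma IsWeakDeriv.sqSemi_lt_top (hs0 : 0 < s) (hs1 : s < 1) (hw : IsWeakDeriv 1 h g)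
    (hh : sqNorm h < ∞) (hg : sqNorm g < ∞) : sqSemi s h < ∞ := by
  refine sqSemi_lt_top_of_le hs0 hs1 hw.1.aestronglyMeasurable hh (A := 0) (by simp) hg.ne
    fun r _ => ?_
  rw [Pi.zero_apply, zero_add, mul_comm]
  exact hw.sqIncr_le r

/-- Cauchy–Schwarz on `(-1, 1)`; the factor `2` is the length of the interval. -/
lemma enorm_integral_mul_sq_le {ψ f : ℝ → ℝ} {M : ℝ} (hM : ∀ r, |ψ r| ≤ M)
    (h0 : ∀ r, r ∉ Ioo (-1 : ℝ) 1 → ψ r = 0) (hf : AEStronglyMeasurable f volume) :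
    ‖∫ r, f r * ψ r‖ₑ ^ 2 ≤ 2 * ENNReal.ofReal M ^ 2 * ∫⁻ r in Ioo (-1 : ℝ) 1, ‖f r‖ₑ ^ 2 := by
  have e : ∫ r, f r * ψ r = ∫ r in Ioo (-1 : ℝ) 1, f r * ψ r :=
    (setIntegral_eq_integral_of_forall_compl_eq_zero fun r hr => by simp [h0 r hr]).symm
  have h₁ : ‖∫ r, f r * ψ r‖ₑ ≤ ENNReal.ofReal M * ∫⁻ r in Ioo (-1 : ℝ) 1, ‖f r‖ₑ := by
    rw [e, ← lintegral_const_mul' _ _ (by simp)]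
    refine (enorm_integral_le_lintegral_enorm _).trans (lintegral_mono fun r => ?_)
    rw [enorm_mul, mul_comm]
    gcongr
    rw [Real.enorm_eq_ofReal_abs]
    exact ENNReal.ofReal_le_ofReal (hM r)
  calc ‖∫ r, f r * ψ r‖ₑ ^ 2 ≤ (ENNReal.ofReal M * ∫⁻ r in Ioo (-1 : ℝ) 1, ‖f r‖ₑ) ^ 2 := by gcongr
    _ = ENNReal.ofReal M ^ 2 * (∫⁻ r in Ioo (-1 : ℝ) 1, ‖f r‖ₑ) ^ 2 := mul_pow _ _ _
    _ ≤ ENNReal.ofReal M ^ 2 * (2 * ∫⁻ r in Ioo (-1 : ℝ) 1, ‖f r‖ₑ ^ 2) := by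
        gcongr
        refine (sq_lintegral_le hf.restrict.enorm).trans_eq ?_
        congr 1
        rw [Measure.restrict_apply_univ, Real.volume_Ioo]
        norm_num
    _ = _ := by ring

lemma tsupport_iteratedDeriv_subset (φ : ℝ → ℝ) (j : ℕ) :
    tsupport (iteratedDeriv j φ) ⊆ tsupport φ := by
  induction j with
  | zero => simp
  | succ n ih => rw [iteratedDeriv_succ]; exact tsupport_deriv_subset.trans ih

/-- Interpolation: a weak derivative of a square integrable function is square integrable as soon
as its short increments are. -/
lemma IsWeakDeriv.sqNorm_lt_top {j : ℕ} (hw : IsWeakDeriv j u h) (hu : sqNorm u < ∞)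
    (hn : nearIncr h < ∞) : sqNorm h < ∞ := by
  -- Outer radius `1 / 2` keeps the closed support inside `(-1, 1)`, the range of increments seen by
  -- `nearIncr`.
  let b : ContDiffBump (0 : ℝ) := ⟨1 / 4, 1 / 2, by norm_num, by norm_num⟩
  set φ : ℝ → ℝ := b.normed volume with hφdef
  have hφ : ContDiff ℝ ((⊤ : ℕ∞) : WithTop ℕ∞) φ := b.contDiff_normed
  have hc : HasCompactSupport φ := b.hasCompactSupport_normed
  have hint : ∫ r, φ r = 1 := b.integral_normed
  have hz : ∀ i, ∀ r, r ∉ Ioo (-1 : ℝ) 1 → iteratedDeriv i φ r = 0 := fun i r hr => by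
    refine image_eq_zero_of_notMem_tsupport fun hr' => hr ?_
    have h₁ := tsupport_iteratedDeriv_subset φ i hr'
    rw [hφdef, b.tsupport_normed_eq, Metric.mem_closedBall, dist_zero_right,
      Real.norm_eq_abs] at h₁
    have h₂ : |r| ≤ 1 / 2 := h₁
    rw [mem_Ioo, ← abs_lt]
    linarith
  have hb : ∀ i, ∃ M : ℝ, ∀ r, |iteratedDeriv i φ r| ≤ M := fun i =>
    (hasCompactSupport_iteratedDeriv hc i).exists_bound_of_continuous
      (contDiff_iteratedDeriv hφ i).continuous
  obtain ⟨M₀, hM₀⟩ := hb 0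
  obtain ⟨M₁, hM₁⟩ := hb j
  have hz₀ := hz 0
  simp only [iteratedDeriv_zero] at hM₀ hz₀
  have hum := hw.1.aestronglyMeasurable
  have hhm := hw.2.1.aestronglyMeasurable
  -- As `φ` has integral one, `h x` is its local average minus the average of its increments. In the
  -- first average all `j` derivatives pass to the mollifier, leaving only `u`.
  have hx : ∀ x, h x = (-1) ^ j * (∫ r, u (x + r) * iteratedDeriv j φ r)
      - ∫ r, (h (x + r) - h x) * φ r := by
    intro x
    have hφx : ContDiff ℝ ((⊤ : ℕ∞) : WithTop ℕ∞) (fun y => φ (y - x)) := by fun_prop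
    have hcx : HasCompactSupport (fun y => φ (y - x)) :=
      hc.comp_homeomorph (Homeomorph.subRight x)
    have e := hw.2.2 _ hφx hcx
    rw [iteratedDeriv_comp_sub_const, ← integral_add_left_eq_self _ x,
      ← integral_add_left_eq_self (fun y => h y * φ (y - x)) x] at e
    simp only [add_sub_cancel_left] at e
    have i₁ : Integrable (fun r => h (x + r) * φ r) := by
      have := (integrable_mul_of_hasCompactSupport hw.2.1 hφx.continuous hcx).comp_add_left x
      simpa using this
    have i₂ : Integrable (fun r => h x * φ r) :=
      (hφ.continuous.integrable_of_hasCompactSupport hc).const_mul _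
    simp only [sub_mul]
    rw [integral_sub i₁ i₂, integral_const_mul, hint, e, ← mul_assoc, ← mul_pow]
    norm_num
  set C : ℝ≥0∞ := 4 * ENNReal.ofReal M₁ ^ 2
  set D : ℝ≥0∞ := 4 * ENNReal.ofReal M₀ ^ 2
  have hC : C ≠ ∞ := ENNReal.mul_ne_top (by simp) (by simp)
  have hD : D ≠ ∞ := ENNReal.mul_ne_top (by simp) (by simp)
  have hsq : ∀ x, ‖h x‖ₑ ^ 2 ≤ C * (∫⁻ r in Ioo (-1 : ℝ) 1, ‖u (r + x)‖ₑ ^ 2)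
      + D * ∫⁻ r in Ioo (-1 : ℝ) 1, ‖h (r + x) - h x‖ₑ ^ 2 := by
    intro x
    have b₁ := enorm_integral_mul_sq_le hM₁ (hz j) (aestronglyMeasurable_comp_add hum x)
    have b₂ := enorm_integral_mul_sq_le hM₀ hz₀
      ((aestronglyMeasurable_comp_add hhm x).sub (aestronglyMeasurable_const (b := h x)))
    refine (congrArg (‖·‖ₑ ^ 2) (hx x)).trans_le ((enorm_sub_sq_le _ _).trans ?_)
    rw [enorm_mul, enorm_pow, enorm_neg, enorm_one, one_pow, one_mul]
    simp only [add_comm x, Pi.sub_apply] at b₁ b₂ ⊢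
    calc _ ≤ 2 * (2 * ENNReal.ofReal M₁ ^ 2 * ∫⁻ r in Ioo (-1 : ℝ) 1, ‖u (r + x)‖ₑ ^ 2)
        + 2 * (2 * ENNReal.ofReal M₀ ^ 2 * ∫⁻ r in Ioo (-1 : ℝ) 1, ‖h (r + x) - h x‖ₑ ^ 2) := by
          gcongr
      _ = _ := by simp only [C, D]; ring
  set ν : Measure ℝ := volume.restrict (Ioo (-1 : ℝ) 1) with hν
  have mu : AEMeasurable (fun p : ℝ × ℝ => ‖u (p.1 + p.2)‖ₑ ^ 2) (ν.prod volume) :=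
    ((aestronglyMeasurable_prod_add volume hum).enorm.pow_const 2).mono_measure
      (Measure.prod_mono Measure.restrict_le_self le_rfl)
  have mh : AEMeasurable (fun p : ℝ × ℝ => ‖h (p.1 + p.2) - h p.2‖ₑ ^ 2) (ν.prod volume) :=
    (aemeasurable_sqIncr_integrand hhm).mono_measure
      (Measure.prod_mono Measure.restrict_le_self le_rfl)
  have mu' : AEMeasurable (fun x => C * ∫⁻ r, ‖u (r + x)‖ₑ ^ 2 ∂ν) :=
    (mu.prod_swap.lintegral_prod_right').const_mul C
  calc sqNorm h ≤ ∫⁻ x, (C * (∫⁻ r, ‖u (r + x)‖ₑ ^ 2 ∂ν)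
        + D * ∫⁻ r, ‖h (r + x) - h x‖ₑ ^ 2 ∂ν) := lintegral_mono hsq
    _ = C * (∫⁻ r, (∫⁻ x, ‖u (r + x)‖ₑ ^ 2) ∂ν)
        + D * ∫⁻ r, (∫⁻ x, ‖h (r + x) - h x‖ₑ ^ 2) ∂ν := by
      rw [lintegral_add_left' mu', lintegral_const_mul' _ _ hC, lintegral_const_mul' _ _ hD,
        ← lintegral_lintegral_swap (f := fun r x => ‖u (r + x)‖ₑ ^ 2) mu,
        ← lintegral_lintegral_swap (f := fun r x => ‖h (r + x) - h x‖ₑ ^ 2) mh]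
    _ = C * (2 * sqNorm u) + D * nearIncr h := by
      have e : ∀ r, ∫⁻ x, ‖u (r + x)‖ₑ ^ 2 = sqNorm u := fun r => by
        simp_rw [add_comm r, sqNorm_comp_add]
      simp_rw [nearIncr, sqIncr_eq, e]
      rw [lintegral_const, hν, Measure.restrict_apply_univ, Real.volume_Ioo]
      norm_num [mul_comm]
    _ < ∞ := ENNReal.add_lt_top.2 ⟨ENNReal.mul_lt_top hC.lt_top (ENNReal.mul_lt_top (by simp) hu),
      ENNReal.mul_lt_top hD.lt_top hn⟩

end Seminorm

/-! ### Multiplication by smooth cutoffs on `H^s` -/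

section Multipliers

variable {s : ℝ} {h u : ℝ → ℝ}

lemma sqNorm_lt_top_iff (hm : AEStronglyMeasurable h volume) : sqNorm h < ∞ ↔ MemLp h 2 volume := by
  rw [MemLp, and_iff_right hm, eLpNorm_lt_top_iff_lintegral_rpow_enorm_lt_top (by simp) (by simp)]
  simp [sqNorm]

lemma locallyIntegrable_of_sqNorm_lt_top (hm : AEStronglyMeasurable h volume)
    (h2 : sqNorm h < ∞) : LocallyIntegrable h volume :=
  ((sqNorm_lt_top_iff hm).1 h2).locallyIntegrable (by norm_num)

lemma IsWeakDeriv.congr_left {j : ℕ} {u v g : ℝ → ℝ} (h₁ : IsWeakDeriv j u g)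
    (e : u =ᵐ[volume] v) : IsWeakDeriv j v g :=
  ⟨h₁.1.congr e, h₁.2.1, fun φ hφ hc => by
    rw [← h₁.2.2 φ hφ hc]
    exact integral_congr_ae (e.symm.mul (ae_eq_refl _))⟩

/-- Membership in `H^s(ℝ)`. -/
structure MemHs (s : ℝ) (h : ℝ → ℝ) : Prop where
  aestronglyMeasurable : AEStronglyMeasurable h volume
  sqNorm_lt_top : sqNorm h < ∞
  sqSemi_lt_top : sqSemi s h < ∞

lemma MemHs.add {g : ℝ → ℝ} (hg : MemHs s g) (hh : MemHs s h) : MemHs s (fun x => g x + h x) where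
  aestronglyMeasurable := hg.1.add hh.1
  sqNorm_lt_top := (sqNorm_add_le hh.1).trans_lt (ENNReal.add_lt_top.2
    ⟨ENNReal.mul_lt_top (by simp) hg.2, ENNReal.mul_lt_top (by simp) hh.2⟩)
  sqSemi_lt_top := (sqSemi_add_le hh.1).trans_lt (ENNReal.add_lt_top.2
    ⟨ENNReal.mul_lt_top (by simp) hg.3, ENNReal.mul_lt_top (by simp) hh.3⟩)

/-- If `u` and its top weak derivative are controlled, so are the intermediate ones. -/
lemma memHs_of_isWeakDeriv (hs0 : 0 < s) (hs1 : s < 1) {k : ℕ} {g : ℕ → ℝ → ℝ}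
    (hu : sqNorm u < ∞) (hw : ∀ j ≤ k, IsWeakDeriv j u (g j)) (hk : MemHs s (g k)) :
    ∀ j ≤ k, MemHs s (g j) := by
  intro j hj
  induction hj using Nat.decreasingInduction with
  | self => exact hk
  | of_succ j hj ih =>
    -- Descending from `j + 1` to `j`: a square integrable next derivative controls the short
    -- increments, interpolation with `u` gives the `L²` bound, and both together give the seminorm.
    have w₀ := hw j (Nat.le_of_lt hj)
    have w := w₀.one_of_succ (hw (j + 1) hj)
    have n := w₀.sqNorm_lt_top hu (w.nearIncr_lt_top ih.sqNorm_lt_top)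
    exact ⟨w₀.2.1.aestronglyMeasurable, n, w.sqSemi_lt_top hs0 hs1 n ih.sqNorm_lt_top⟩

/-- A sequence of smooth multipliers, all of whose derivatives are uniformly bounded and converge
to zero pointwise. -/
structure IsNullMultiplier (θ : ℕ → ℝ → ℝ) : Prop where
  contDiff : ∀ n, ContDiff ℝ ((⊤ : ℕ∞) : WithTop ℕ∞) (θ n)
  bounded : ∀ i, ∃ C : ℝ, ∀ n x, |iteratedDeriv i (θ n) x| ≤ C
  tendsto : ∀ i x, Tendsto (fun n => iteratedDeriv i (θ n) x) atTop (𝓝 0)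

variable {θ : ℕ → ℝ → ℝ}

lemma IsNullMultiplier.deriv (hθ : IsNullMultiplier θ) :
    IsNullMultiplier (fun n => deriv (θ n)) where
  contDiff n := contDiff_deriv (hθ.contDiff n)
  bounded i := by simpa only [← iteratedDeriv_succ'] using hθ.bounded (i + 1)
  tendsto i := by simpa only [← iteratedDeriv_succ'] using hθ.tendsto (i + 1)

/-- The increments of a product with a bounded Lipschitz function. -/
lemma sqIncr_mul_le {χ : ℝ → ℝ} {C L : ℝ} (hC : ∀ x, |χ x| ≤ C)
    (hm : AEStronglyMeasurable h volume) (r : ℝ)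
    (hL : ∀ x, |χ (x + r) - χ x| ≤ L * min 1 |r|) :
    sqIncr (fun x => χ x * h x) r ≤ 2 * ENNReal.ofReal C ^ 2 * sqIncr h r
      + 2 * ENNReal.ofReal L ^ 2 * sqNorm h * ENNReal.ofReal (min 1 (r ^ 2)) := by
  have hL0 : 0 ≤ L * min 1 |r| := (abs_nonneg _).trans (hL 0)
  have hmin : min 1 |r| ^ 2 = min 1 (r ^ 2) := by
    rcases le_total |r| 1 with h1 | h1
    · rw [min_eq_right h1, sq_abs, min_eq_right]; rw [← sq_abs]; nlinarith [abs_nonneg r]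
    · rw [min_eq_left h1, min_eq_left]
      · norm_num
      · rw [← sq_abs]; nlinarith
  have hmm : AEMeasurable (fun x => 2 * (ENNReal.ofReal (L * min 1 |r|) ^ 2 * ‖h x‖ₑ ^ 2)) :=
    ((hm.enorm.pow_const 2).const_mul _).const_mul 2
  calc sqIncr (fun x => χ x * h x) r
      ≤ ∫⁻ x, (2 * (ENNReal.ofReal C ^ 2 * ‖h (x + r) - h x‖ₑ ^ 2)
        + 2 * (ENNReal.ofReal (L * min 1 |r|) ^ 2 * ‖h x‖ₑ ^ 2)) := by
        refine lintegral_mono fun x => ?_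
        have e : χ (x + r) * h (x + r) - χ x * h x
            = χ (x + r) * (h (x + r) - h x) + (χ (x + r) - χ x) * h x := by ring
        simp only [e]
        refine (enorm_add_sq_le _ _).trans ?_
        rw [enorm_mul, enorm_mul, mul_pow, mul_pow]
        gcongr
        · rw [Real.enorm_eq_ofReal_abs]; exact ENNReal.ofReal_le_ofReal (hC _)
        · rw [Real.enorm_eq_ofReal_abs]; exact ENNReal.ofReal_le_ofReal (hL _)
    _ = 2 * (ENNReal.ofReal C ^ 2 * sqIncr h r)
        + 2 * (ENNReal.ofReal (L * min 1 |r|) ^ 2 * sqNorm h) := by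
        rw [lintegral_add_right' _ hmm, lintegral_const_mul' _ _ (by simp),
          lintegral_const_mul' _ _ (by simp), lintegral_const_mul' _ _ (by simp),
          lintegral_const_mul' _ _ (by simp), sqIncr, sqNorm]
    _ = _ := by
        -- At `r = 0` the Lipschitz hypothesis says nothing about the sign of `L`; otherwise it
        -- forces `0 ≤ L`.
        by_cases hr : r = 0
        · subst hr; simp; ring
        have hmp : 0 < min 1 |r| := lt_min one_pos (abs_pos.2 hr)
        have hLn : 0 ≤ L := nonneg_of_mul_nonneg_left hL0 hmp
        rw [ENNReal.ofReal_mul hLn, mul_pow, ← ENNReal.ofReal_pow hmp.le, hmin]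
        ring

lemma sqNorm_mul_le {χ : ℝ → ℝ} {C : ℝ} (hC : ∀ x, |χ x| ≤ C) (h : ℝ → ℝ) :
    sqNorm (fun x => χ x * h x) ≤ ENNReal.ofReal C ^ 2 * sqNorm h := by
  rw [sqNorm, sqNorm, ← lintegral_const_mul' _ _ (by simp)]
  refine lintegral_mono fun x => ?_
  rw [enorm_mul, mul_pow]
  gcongr
  rw [Real.enorm_eq_ofReal_abs]
  exact ENNReal.ofReal_le_ofReal (hC _)

/-- Dominated convergence in `x` for fixed `r`, with the uniform bound on the multipliers supplying
the majorant. -/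
lemma tendsto_sqIncr_mul (hθ : IsNullMultiplier θ) (hm : AEStronglyMeasurable h volume)
    (h2 : sqNorm h < ∞) (r : ℝ) :
    Tendsto (fun n => sqIncr (fun x => θ n x * h x) r) atTop (𝓝 0) := by
  obtain ⟨C, hC⟩ := hθ.bounded 0
  have ht := hθ.tendsto 0
  simp only [iteratedDeriv_zero] at hC ht
  have hmn : ∀ n, AEStronglyMeasurable (fun x => θ n x * h x) volume := fun n =>
    (hθ.contDiff n).continuous.aestronglyMeasurable.mul hm
  set B : ℝ → ℝ≥0∞ := fun x => 2 * ENNReal.ofReal C ^ 2 * ‖h (x + r)‖ₑ ^ 2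
    + 2 * ENNReal.ofReal C ^ 2 * ‖h x‖ₑ ^ 2
  have hB : ∫⁻ x, B x ≠ ∞ := by
    have hc : (2 * ENNReal.ofReal C ^ 2 : ℝ≥0∞) ≠ ∞ := ENNReal.mul_ne_top (by simp) (by simp)
    simp only [B]
    rw [lintegral_add_right' _ ((hm.enorm.pow_const 2).const_mul _),
      lintegral_const_mul' _ _ hc, lintegral_const_mul' _ _ hc, sqNorm_comp_add]
    exact (ENNReal.add_lt_top.2 ⟨ENNReal.mul_lt_top hc.lt_top h2,
      ENNReal.mul_lt_top hc.lt_top h2⟩).ne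
  have key := tendsto_lintegral_of_dominated_convergence' (μ := volume)
    (F := fun n x => ‖θ n (x + r) * h (x + r) - θ n x * h x‖ₑ ^ 2) (f := fun _ => 0) B
    (fun n => ((aestronglyMeasurable_comp_add (hmn n) r).sub (hmn n)).enorm.pow_const 2)
    (fun n => ae_of_all _ fun x => by
      refine (enorm_sub_sq_le _ _).trans ?_
      rw [enorm_mul, enorm_mul, mul_pow, mul_pow, ← mul_assoc, ← mul_assoc]
      have b : ∀ y, ‖θ n y‖ₑ ≤ ENNReal.ofReal C := fun y => by
        rw [Real.enorm_eq_ofReal_abs]; exact ENNReal.ofReal_le_ofReal (hC n y)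
      simp only [B]
      gcongr <;> exact b _) hB
    (ae_of_all _ fun x => by
      have := ((ht (x + r)).mul_const (h (x + r))).sub ((ht x).mul_const (h x))
      simp only [zero_mul, sub_zero] at this
      simpa using ENNReal.Tendsto.pow (n := 2) this.enorm)
  simpa [sqIncr] using key

/-- The sup bound handles long increments and the derivative bound short ones. The factor `min 1
|r|` is what makes the kernel integrable at both ends after squaring. -/
lemma IsNullMultiplier.exists_lipschitz (hθ : IsNullMultiplier θ) :
    ∃ L : ℝ, ∀ n x r, |θ n (x + r) - θ n x| ≤ L * min 1 |r| := by
  obtain ⟨C, hC⟩ := hθ.bounded 0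
  obtain ⟨C', hC'⟩ := hθ.bounded 1
  simp only [iteratedDeriv_zero, iteratedDeriv_one] at hC hC'
  have hC0 : 0 ≤ C := (abs_nonneg _).trans (hC 0 0)
  have hC0' : 0 ≤ C' := (abs_nonneg _).trans (hC' 0 0)
  refine ⟨2 * C + C', fun n x r => ?_⟩
  have b₁ : |θ n (x + r) - θ n x| ≤ 2 * C := by
    have := abs_sub (θ n (x + r)) (θ n x)
    linarith [hC n (x + r), hC n x]
  have b₂ : |θ n (x + r) - θ n x| ≤ C' * |r| := by
    have := Convex.norm_image_sub_le_of_norm_deriv_le (f := θ n) (s := univ) (C := C') (x := x)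
      (y := x + r) (fun y _ => (hθ.contDiff n).differentiable (by simp) y)
      (fun y _ => hC' n y) convex_univ (mem_univ _) (mem_univ _)
    simpa using this
  rcases le_total 1 |r| with h1 | h1
  · rw [min_eq_left h1]; linarith
  · rw [min_eq_right h1]; nlinarith [abs_nonneg r, mul_nonneg hC0 (abs_nonneg r)]

/-- Multiplication with a null sequence of multipliers is strongly null on `H^s(ℝ)`. -/
lemma IsNullMultiplier.sqSemi_mul (hθ : IsNullMultiplier θ) (hs0 : 0 < s) (hs1 : s < 1)
    (hh : MemHs s h) : (∀ n, MemHs s (fun x => θ n x * h x)) ∧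
      Tendsto (fun n => sqSemi s (fun x => θ n x * h x)) atTop (𝓝 0) := by
  obtain ⟨hm, h2, h3⟩ := hh
  obtain ⟨L, hL⟩ := hθ.exists_lipschitz
  obtain ⟨C, hC⟩ := hθ.bounded 0
  simp only [iteratedDeriv_zero] at hC
  have hmn : ∀ n, AEStronglyMeasurable (fun x => θ n x * h x) volume := fun n =>
    (hθ.contDiff n).continuous.aestronglyMeasurable.mul hm
  set a : ℝ≥0∞ := 2 * ENNReal.ofReal C ^ 2
  set b : ℝ≥0∞ := 2 * ENNReal.ofReal L ^ 2 * sqNorm h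
  have ha : a ≠ ∞ := ENNReal.mul_ne_top (by simp) (by simp)
  have hb : b ≠ ∞ := ENNReal.mul_ne_top (ENNReal.mul_ne_top (by simp) (by simp)) h2.ne
  -- A majorant in `r` independent of `n`: the seminorm of `h` plus the error from differences of
  -- the multiplier.
  set B : ℝ → ℝ≥0∞ := fun r => a * (fracKernel s r * sqIncr h r)
    + b * (fracKernel s r * ENNReal.ofReal (min 1 (r ^ 2)))
  have hB : ∫⁻ r, B r ≠ ∞ := by
    have m : Measurable (fun r => b * (fracKernel s r * ENNReal.ofReal (min 1 (r ^ 2)))) :=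
      ((measurable_fracKernel s).mul (by fun_prop)).const_mul b
    simp only [B]
    rw [lintegral_add_right _ m, lintegral_const_mul' _ _ ha, lintegral_const_mul' _ _ hb]
    exact (ENNReal.add_lt_top.2 ⟨ENNReal.mul_lt_top ha.lt_top h3, ENNReal.mul_lt_top hb.lt_top
      (lintegral_fracKernel_mul_min_lt_top hs0 hs1)⟩).ne
  have hle : ∀ n r, fracKernel s r * sqIncr (fun x => θ n x * h x) r ≤ B r := by
    intro n r
    calc _ ≤ fracKernel s r * (a * sqIncr h r + b * ENNReal.ofReal (min 1 (r ^ 2))) := by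
          gcongr
          exact sqIncr_mul_le (hC n) hm r fun x => hL n x r
      _ = B r := by simp only [B]; ring
  refine ⟨fun n => ⟨hmn n, ?_, ?_⟩, ?_⟩
  · exact (sqNorm_mul_le (hC n) h).trans_lt (ENNReal.mul_lt_top (by simp) h2)
  · exact (lintegral_mono (hle n)).trans_lt hB.lt_top
  · have key := tendsto_lintegral_of_dominated_convergence' (μ := volume)
      (F := fun n r => fracKernel s r * sqIncr (fun x => θ n x * h x) r) (f := fun _ => 0) B
      (fun n => (measurable_fracKernel s).aemeasurable.mul (aemeasurable_sqIncr (hmn n)))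
      (fun n => ae_of_all _ (hle n)) hB
      (ae_of_all _ fun r => by
        simpa using ENNReal.Tendsto.const_mul (tendsto_sqIncr_mul hθ hm h2 r)
          (Or.inr (fracKernel_ne_top s r)))
    simpa [sqSemi] using key

/-- The weak derivatives of the products of `g 0 ∈ H^{j+s}(ℝ)` with a null sequence of
multipliers tend to zero in the Gagliardo seminorm. -/
lemma IsNullMultiplier.exists_isWeakDeriv (hs0 : 0 < s) (hs1 : s < 1) (j : ℕ) :
    ∀ {g : ℕ → ℝ → ℝ} {θ : ℕ → ℝ → ℝ}, IsNullMultiplier θ →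
      (∀ i < j, IsWeakDeriv 1 (g i) (g (i + 1))) → (∀ i ≤ j, MemHs s (g i)) →
      ∃ r : ℕ → ℝ → ℝ, (∀ n, IsWeakDeriv j (fun x => θ n x * g 0 x) (r n)) ∧
        (∀ n, MemHs s (r n)) ∧ Tendsto (fun n => sqSemi s (r n)) atTop (𝓝 0) := by
  induction j with
  | zero =>
    intro g θ hθ _ hg
    obtain ⟨h₁, h₂⟩ := hθ.sqSemi_mul hs0 hs1 (hg 0 le_rfl)
    exact ⟨_, fun n => IsWeakDeriv.zero
      (locallyIntegrable_of_sqNorm_lt_top (h₁ n).1 (h₁ n).2), h₁, h₂⟩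
  | succ j ih =>
    intro g θ hθ hw hg
    -- By the product rule, `(θ * g 0)' = θ * g 1 + θ' * g 0`. The induction hypothesis applies to
    -- the shifted sequence with `θ`, and to the original one with `θ'`, again a null multiplier.
    obtain ⟨r₁, w₁, m₁, t₁⟩ := ih (g := fun i => g (i + 1)) hθ (fun i hi => hw (i + 1) (by omega))
      (fun i hi => hg (i + 1) (by omega))
    obtain ⟨r₂, w₂, m₂, t₂⟩ := ih hθ.deriv (fun i hi => hw i (by omega))
      (fun i hi => hg i (by omega))
    refine ⟨fun n x => r₁ n x + r₂ n x, fun n => ?_, fun n => (m₁ n).add (m₂ n), ?_⟩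
    · exact ((hw 0 (Nat.succ_pos j)).smooth_mul (hθ.contDiff n)).succ ((w₁ n).add (w₂ n))
    · refine tendsto_of_tendsto_of_tendsto_of_le_of_le tendsto_const_nhds ?_ (fun n => zero_le)
        (fun n => sqSemi_add_le (m₂ n).1)
      simpa using (ENNReal.Tendsto.const_mul t₁ (Or.inr (by simp : (2 : ℝ≥0∞) ≠ ∞))).add
        (ENNReal.Tendsto.const_mul t₂ (Or.inr (by simp : (2 : ℝ≥0∞) ≠ ∞)))

end Multipliers

/-! ### The smooth transition and the far cutoffs -/

section Cutoff

variable {f : ℝ → ℝ} {c d : ℝ}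

lemma iteratedDeriv_eq_of_eq_const (j : ℕ) {S : Set ℝ} (hS : IsOpen S) (hf : ∀ x ∈ S, f x = c)
    {x : ℝ} (hx : x ∈ S) : iteratedDeriv j f x = if j = 0 then c else 0 := by
  have e : f =ᶠ[𝓝 x] fun _ => c := by
    filter_upwards [hS.mem_nhds hx] with y hy using hf y hy
  rw [e.iteratedDeriv_eq j, iteratedDeriv_const]

lemma hasCompactSupport_deriv_of_eventually_const (hc : ∀ x ∈ Ioi (1 : ℝ), f x = c)
    (hd : ∀ x ∈ Iio (-1 : ℝ), f x = d) : HasCompactSupport (deriv f) := by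
  refine HasCompactSupport.intro (isCompact_Icc (a := -1) (b := 1)) fun x hx => ?_
  rw [← iteratedDeriv_one]
  rcases not_and_or.1 hx with h | h
  · rw [iteratedDeriv_eq_of_eq_const 1 isOpen_Iio hd (not_le.1 h)]; simp
  · rw [iteratedDeriv_eq_of_eq_const 1 isOpen_Ioi hc (not_le.1 h)]; simp

lemma exists_bound_iteratedDeriv (hf : ContDiff ℝ ((⊤ : ℕ∞) : WithTop ℕ∞) f)
    (hc : ∀ x ∈ Ioi (1 : ℝ), f x = c) (hd : ∀ x ∈ Iio (-1 : ℝ), f x = d) (j : ℕ) :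
    ∃ C : ℝ, ∀ x, |iteratedDeriv j f x| ≤ C := by
  cases j with
  | zero =>
    obtain ⟨C, hC⟩ := (isCompact_Icc (a := (-1 : ℝ)) (b := 1)).exists_bound_of_continuousOn
      hf.continuous.continuousOn
    refine ⟨max C (max |c| |d|), fun x => ?_⟩
    rw [iteratedDeriv_zero]
    by_cases hx : x ∈ Icc (-1 : ℝ) 1
    · exact (hC x hx).trans (le_max_left _ _)
    · rcases not_and_or.1 hx with h | h
      · rw [hd x (not_le.1 h)]; exact (le_max_right _ _).trans (le_max_right _ _)
      · rw [hc x (not_le.1 h)]; exact (le_max_left _ _).trans (le_max_right _ _)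
  | succ j =>
    rw [iteratedDeriv_succ']
    exact (hasCompactSupport_iteratedDeriv (hasCompactSupport_deriv_of_eventually_const hc hd)
      j).exists_bound_of_continuous (contDiff_iteratedDeriv (contDiff_deriv hf) j).continuous

/-- Short increments of the derivatives of a smooth transition. -/
lemma exists_sqIncr_iteratedDeriv_le (hf : ContDiff ℝ ((⊤ : ℕ∞) : WithTop ℕ∞) f)
    (hc : ∀ x ∈ Ioi (1 : ℝ), f x = c) (hd : ∀ x ∈ Iio (-1 : ℝ), f x = d) (j : ℕ) :
    ∃ C : ℝ≥0∞, C ≠ ∞ ∧ ∀ r ∈ Ioo (-1 : ℝ) 1,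
      sqIncr (iteratedDeriv j f) r ≤ C * ENNReal.ofReal |r| ^ 2 := by
  obtain ⟨M, hM⟩ := exists_bound_iteratedDeriv hf hc hd (j + 1)
  have hM0 : 0 ≤ M := (abs_nonneg _).trans (hM 0)
  refine ⟨4 * ENNReal.ofReal M ^ 2, ENNReal.mul_ne_top (by simp) (by simp), fun r hr => ?_⟩
  -- For `|r| < 1` and `|x| > 2` both points lie on the same constant end of `f`, so the increment
  -- lives on `[-2, 2]`; there the mean value inequality applies.
  have hle : ∀ x, ‖iteratedDeriv j f (x + r) - iteratedDeriv j f x‖ₑ ^ 2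
      ≤ (Icc (-2 : ℝ) 2).indicator (fun _ => (ENNReal.ofReal M * ENNReal.ofReal |r|) ^ 2) x := by
    intro x
    by_cases hx : x ∈ Icc (-2 : ℝ) 2
    · rw [indicator_of_mem hx, ← ENNReal.ofReal_mul hM0, Real.enorm_eq_ofReal_abs]
      gcongr
      have := Convex.norm_image_sub_le_of_norm_deriv_le (f := iteratedDeriv j f) (s := univ)
        (C := M) (x := x) (y := x + r)
        (fun y _ => (contDiff_iteratedDeriv hf j).differentiable (by simp) y)
        (fun y _ => by rw [← iteratedDeriv_succ]; exact hM y) convex_univ (mem_univ _) (mem_univ _)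
      simpa using this
    · rw [indicator_of_notMem hx]
      rcases not_and_or.1 hx with h | h
      · have h₁ : x ∈ Iio (-1 : ℝ) := by rw [mem_Iio]; linarith
        have h₂ : x + r ∈ Iio (-1 : ℝ) := by rw [mem_Iio]; linarith [hr.2]
        rw [iteratedDeriv_eq_of_eq_const j isOpen_Iio hd h₁,
          iteratedDeriv_eq_of_eq_const j isOpen_Iio hd h₂]
        simp
      · have h₁ : x ∈ Ioi (1 : ℝ) := by rw [mem_Ioi]; linarith
        have h₂ : x + r ∈ Ioi (1 : ℝ) := by rw [mem_Ioi]; linarith [hr.1]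
        rw [iteratedDeriv_eq_of_eq_const j isOpen_Ioi hc h₁,
          iteratedDeriv_eq_of_eq_const j isOpen_Ioi hc h₂]
        simp
  refine (lintegral_mono hle).trans_eq ?_
  rw [lintegral_indicator measurableSet_Icc, setLIntegral_const, Real.volume_Icc, mul_pow]
  norm_num
  ring

/-- A smooth odd transition from `-1` to `1`. -/
def smoothSign (x : ℝ) : ℝ := 2 * Real.smoothTransition ((x + 1) / 2) - 1

lemma contDiff_smoothSign : ContDiff ℝ ((⊤ : ℕ∞) : WithTop ℕ∞) smoothSign := by
  have h := Real.smoothTransition.contDiff (n := ⊤)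
  unfold smoothSign
  fun_prop

lemma smoothSign_of_one_le {x : ℝ} (hx : 1 ≤ x) : smoothSign x = 1 := by
  rw [smoothSign, Real.smoothTransition.one_of_one_le (by linarith)]; norm_num

lemma smoothSign_of_le_neg_one {x : ℝ} (hx : x ≤ -1) : smoothSign x = -1 := by
  rw [smoothSign, Real.smoothTransition.zero_of_nonpos (by linarith)]; norm_num

lemma smoothSign_eq_sign {x : ℝ} (hx : 1 ≤ |x|) : smoothSign x = Real.sign x := by
  rcases le_abs.1 hx with h | h
  · rw [smoothSign_of_one_le h, Real.sign_of_pos (by linarith)]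
  · rw [smoothSign_of_le_neg_one (by linarith), Real.sign_of_neg (by linarith)]

/-- Smooth functions that vanish on `[-n, n]` and are equal to one off `[-n - 1, n + 1]`. -/
def farCutoff (n : ℕ) (x : ℝ) : ℝ :=
  Real.smoothTransition (x - n) + Real.smoothTransition (-n - x)

lemma farCutoff_nonneg (n : ℕ) (x : ℝ) : 0 ≤ farCutoff n x :=
  add_nonneg (Real.smoothTransition.nonneg _) (Real.smoothTransition.nonneg _)

/-- A crude bound, enough for `|1 - farCutoff n x| ≤ 1`. -/
lemma farCutoff_le_two (n : ℕ) (x : ℝ) : farCutoff n x ≤ 2 := by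
  have h₁ := Real.smoothTransition.le_one (x - n)
  have h₂ := Real.smoothTransition.le_one (-n - x)
  rw [farCutoff]; linarith

lemma farCutoff_eq_zero {n : ℕ} {x : ℝ} (hx : |x| ≤ n) : farCutoff n x = 0 := by
  have := abs_le.1 hx
  rw [farCutoff, Real.smoothTransition.zero_of_nonpos (by linarith),
    Real.smoothTransition.zero_of_nonpos (by linarith), add_zero]

lemma farCutoff_eq_one {n : ℕ} {x : ℝ} (hx : n + 1 ≤ |x|) : farCutoff n x = 1 := by
  have hn : (0 : ℝ) ≤ n := n.cast_nonneg
  rcases le_abs.1 hx with h | h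
  · rw [farCutoff, Real.smoothTransition.one_of_one_le (by linarith),
      Real.smoothTransition.zero_of_nonpos (by linarith), add_zero]
  · rw [farCutoff, Real.smoothTransition.zero_of_nonpos (by linarith),
      Real.smoothTransition.one_of_one_le (by linarith), zero_add]

/-- All derivatives are translates and reflections of those of one fixed function, hence bounded
uniformly in `n`. At a given `x` they vanish once `n > |x|`. -/
lemma isNullMultiplier_farCutoff : IsNullMultiplier farCutoff := by
  have hρ : ContDiff ℝ ((⊤ : ℕ∞) : WithTop ℕ∞) Real.smoothTransition :=
    Real.smoothTransition.contDiff (n := ⊤)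
  have h₁ : ∀ x ∈ Ioi (1 : ℝ), Real.smoothTransition x = 1 := fun x hx =>
    Real.smoothTransition.one_of_one_le (le_of_lt hx)
  have h₀ : ∀ x ∈ Iio (0 : ℝ), Real.smoothTransition x = 0 := fun x hx =>
    Real.smoothTransition.zero_of_nonpos (le_of_lt hx)
  have e : ∀ i n x, iteratedDeriv i (farCutoff n) x = iteratedDeriv i Real.smoothTransition (x - n)
      + (-1) ^ i * iteratedDeriv i Real.smoothTransition (-n - x) := by
    intro i n x
    have c₁ : ContDiff ℝ i (fun x : ℝ => Real.smoothTransition (x - n)) :=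
      Real.smoothTransition.contDiff.comp (by fun_prop)
    have c₂ : ContDiff ℝ i (fun x : ℝ => Real.smoothTransition (-n - x)) :=
      Real.smoothTransition.contDiff.comp (by fun_prop)
    unfold farCutoff
    rw [iteratedDeriv_fun_add c₁.contDiffAt c₂.contDiffAt, iteratedDeriv_comp_sub_const,
      iteratedDeriv_comp_const_sub]
    simp only [smul_eq_mul]
  refine ⟨fun n => ?_, fun i => ?_, fun i x => ?_⟩
  · unfold farCutoff; fun_prop
  · obtain ⟨C, hC⟩ := exists_bound_iteratedDeriv hρ h₁
      (fun x hx => h₀ x (lt_trans (mem_Iio.1 hx) (by norm_num : (-1 : ℝ) < 0))) i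
    refine ⟨C + C, fun n x => ?_⟩
    rw [e]
    refine (abs_add_le _ _).trans (add_le_add (hC _) ?_)
    rw [abs_mul, abs_pow, abs_neg, abs_one, one_pow, one_mul]
    exact hC _
  · refine tendsto_const_nhds.congr' ?_
    filter_upwards [eventually_gt_atTop ⌈|x|⌉₊] with n hn
    have hxn : |x| < n := Nat.lt_of_ceil_lt hn
    have := abs_lt.1 hxn
    have hz : ∀ y ∈ Iio (0 : ℝ), iteratedDeriv i Real.smoothTransition y = 0 := fun y hy => by
      rw [iteratedDeriv_eq_of_eq_const i isOpen_Iio h₀ hy, ite_self]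
    rw [e, hz _ (by rw [mem_Iio]; linarith), hz _ (by rw [mem_Iio]; linarith)]
    simp

end Cutoff

/-! ### Comparison inequalities for the weighted nonlocal energy -/

section Gagliardo

variable {s : ℝ} {a : ℝ × ℝ → ℝ} {g h : ℝ → ℝ} {I : Set ℝ}

lemma gagliardo_congr (e : g =ᵐ[volume] h) : gagliardo a s I g = gagliardo a s I h := by
  refine lintegral_congr_ae (ae_restrict_of_ae ?_)
  have e₁ : ∀ᵐ p : ℝ × ℝ, g p.1 = h p.1 := Measure.quasiMeasurePreserving_fst.ae e
  have e₂ : ∀ᵐ p : ℝ × ℝ, g p.2 = h p.2 := Measure.quasiMeasurePreserving_snd.ae e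
  filter_upwards [e₁, e₂] with p h₁ h₂
  rw [h₁, h₂]

lemma gagliardo_mono_set {J : Set ℝ} (hIJ : I ⊆ J) : gagliardo a s I g ≤ gagliardo a s J g :=
  lintegral_mono_set (prod_mono hIJ hIJ)

lemma gagliardo_one_le {α : ℝ} (hα : 0 < α) (ha : ∀ᵐ p : ℝ × ℝ, α ≤ a p) :
    gagliardo (fun _ => 1) s I g ≤ ENNReal.ofReal α⁻¹ * gagliardo a s I g := by
  rw [gagliardo, gagliardo, ← lintegral_const_mul' _ _ ENNReal.ofReal_ne_top]
  refine lintegral_mono_ae (ae_restrict_of_ae ?_)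
  filter_upwards [ha] with p hp
  rw [← ENNReal.ofReal_mul (by positivity), ← mul_assoc]
  refine ENNReal.ofReal_le_ofReal ?_
  gcongr
  rwa [inv_mul_eq_div, one_le_div hα]

/-- A quantitative triangle inequality for the weighted Gagliardo energy. -/
lemma gagliardo_sub_le {β δ : ℝ} (hδ : 0 < δ) (ha : ∀ᵐ p : ℝ × ℝ, 0 ≤ a p ∧ a p ≤ β)
    (hm : AEStronglyMeasurable h volume) :
    gagliardo a s I (fun x => g x - h x) ≤ ENNReal.ofReal (1 + δ) * gagliardo a s I g
      + ENNReal.ofReal ((1 + δ⁻¹) * β) * gagliardo (fun _ => 1) s univ h := by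
  have hβ : 0 ≤ β := by
    obtain ⟨p, hp⟩ := ha.exists
    exact hp.1.trans hp.2
  have hF : AEMeasurable (fun p : ℝ × ℝ => ENNReal.ofReal
      (1 * (|h p.1 - h p.2| ^ 2 / |p.1 - p.2| ^ (1 + 2 * s)))) volume :=
    aemeasurable_gagliardo_integrand hm
  refine le_trans ?_ (add_le_add le_rfl (mul_le_mul_right (gagliardo_mono_set (subset_univ I)) _))
  rw [gagliardo, gagliardo, gagliardo, ← lintegral_const_mul' _ _ ENNReal.ofReal_ne_top,
    ← lintegral_const_mul' _ _ ENNReal.ofReal_ne_top,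
    ← lintegral_add_right' _ (hF.restrict.const_mul _)]
  refine lintegral_mono_ae (ae_restrict_of_ae ?_)
  filter_upwards [ha] with p hp
  have hk : 0 ≤ (|p.1 - p.2| ^ (1 + 2 * s))⁻¹ := by positivity
  rw [← ENNReal.ofReal_mul (by positivity), ← ENNReal.ofReal_mul (by positivity),
    ← ENNReal.ofReal_add (by have := hp.1; positivity) (by positivity)]
  refine ENNReal.ofReal_le_ofReal ?_
  simp only [sq_abs, div_eq_mul_inv]
  set A := g p.1 - g p.2
  set B := h p.1 - h p.2
  have e : g p.1 - h p.1 - (g p.2 - h p.2) = A - B := by simp only [A, B]; ring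
  -- Young's inequality with weight `δ`.
  have hAB : (A - B) ^ 2 ≤ (1 + δ) * A ^ 2 + (1 + δ⁻¹) * B ^ 2 := by
    have h₁ : 0 ≤ δ⁻¹ * (δ * A + B) ^ 2 := by positivity
    have h₂ : δ⁻¹ * (δ * A + B) ^ 2 = δ * A ^ 2 + 2 * A * B + δ⁻¹ * B ^ 2 := by
      field_simp
      ring
    nlinarith
  rw [e]
  calc a p * ((A - B) ^ 2 * (|p.1 - p.2| ^ (1 + 2 * s))⁻¹)
      ≤ a p * (((1 + δ) * A ^ 2 + (1 + δ⁻¹) * B ^ 2) * (|p.1 - p.2| ^ (1 + 2 * s))⁻¹) := by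
        have := hp.1
        gcongr
    _ = (1 + δ) * (a p * (A ^ 2 * (|p.1 - p.2| ^ (1 + 2 * s))⁻¹))
        + a p * ((1 + δ⁻¹) * (1 * (B ^ 2 * (|p.1 - p.2| ^ (1 + 2 * s))⁻¹))) := by ring
    _ ≤ _ := by
        rw [mul_comm (1 + δ⁻¹) β, mul_assoc β]
        have := hp.2
        gcongr

end Gagliardo

/-! ### Quadratic behaviour of the potential near the wells -/

section Potential

variable {W : ℝ → ℝ} {v : ℝ → ℝ} {ω : ℝ}

lemma one_sub_abs_add_sq {σ t : ℝ} (hσ : σ = 1 ∨ σ = -1) (ht : |t| ≤ 1) :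
    |σ + t| ≤ 2 ∧ (1 - |σ + t|) ^ 2 = t ^ 2 := by
  have := abs_le.1 ht
  rcases hσ with rfl | rfl
  · rw [abs_of_nonneg (by linarith)]; constructor <;> nlinarith
  · rw [abs_of_nonpos (by linarith)]; constructor <;> nlinarith

lemma mul_smoothSign_eq {x : ℝ} (hω : ω = 1 ∨ ω = -1) (hx : 1 ≤ |x|) :
    ω * smoothSign x = 1 ∨ ω * smoothSign x = -1 := by
  rcases le_abs.1 hx with h | h
  · rw [smoothSign_of_one_le h]; simpa using hω
  · rw [smoothSign_of_le_neg_one (by linarith)]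
    rcases hω with rfl | rfl <;> norm_num

/-- A profile is close to the transition `ω * smoothSign` far away. -/
lemma exists_abs_sub_le_one (ht : Tendsto v atTop (𝓝 ω)) (hb : Tendsto v atBot (𝓝 (-ω))) :
    ∃ R : ℝ, 1 ≤ R ∧ ∀ x, R ≤ |x| → |v x - ω * smoothSign x| ≤ 1 := by
  obtain ⟨R₁, h₁⟩ := eventually_atTop.1 (ht.eventually (Metric.closedBall_mem_nhds ω one_pos))
  obtain ⟨R₂, h₂⟩ := eventually_atBot.1 (hb.eventually (Metric.closedBall_mem_nhds (-ω) one_pos))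
  refine ⟨max 1 (max R₁ (-R₂)), le_max_left _ _, fun x hx => ?_⟩
  simp only [max_le_iff] at hx
  obtain ⟨hx1, hxR₁, hxR₂⟩ := hx
  rcases le_abs.1 hx1 with h | h
  · rw [abs_of_nonneg (by linarith)] at hxR₁
    have := h₁ x hxR₁
    rw [smoothSign_of_one_le h, mul_one]
    simpa [Real.dist_eq] using this
  · rw [abs_of_nonpos (by linarith)] at hxR₂
    have := h₂ x (by linarith)
    rw [smoothSign_of_le_neg_one (by linarith), mul_neg, mul_one]
    simpa [Real.dist_eq] using this

/-- Far out, `v` is within one of a well, so `(1 - |v|) ^ 2` is exactly the squared difference and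
`W (v x)` dominates `α` times it. On the remaining compact interval the difference is bounded by
continuity. -/
lemma sqNorm_sub_smoothSign_lt_top (hW : IsDoubleWell W) (hω : ω = 1 ∨ ω = -1)
    (hv : Continuous v) (ht : Tendsto v atTop (𝓝 ω)) (hb : Tendsto v atBot (𝓝 (-ω)))
    (hE : ∫⁻ x, ENNReal.ofReal (W (v x)) < ∞) :
    sqNorm (fun x => v x - ω * smoothSign x) < ∞ := by
  obtain ⟨R, hR1, hR⟩ := exists_abs_sub_le_one ht hb
  obtain ⟨α, β, hα, hβ, hαβ⟩ := hW.bounds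
  set u : ℝ → ℝ := fun x => v x - ω * smoothSign x with hu
  have huc : Continuous u := hv.sub (continuous_const.mul contDiff_smoothSign.continuous)
  obtain ⟨M, hM⟩ := (isCompact_Icc (a := -R) (b := R)).exists_bound_of_continuousOn
    huc.continuousOn
  have hle : ∀ x, ‖u x‖ₑ ^ 2 ≤ (Icc (-R) R).indicator (fun _ => ENNReal.ofReal M ^ 2) x
      + ENNReal.ofReal α⁻¹ * ENNReal.ofReal (W (v x)) := by
    intro x
    rw [Real.enorm_eq_ofReal_abs]
    by_cases hx : x ∈ Icc (-R) R
    · rw [indicator_of_mem hx]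
      refine le_trans ?_ le_self_add
      gcongr
      exact hM x hx
    · refine le_trans ?_ le_add_self
      have hx' : R ≤ |x| := by
        by_contra hlt
        exact hx (abs_le.1 (not_le.1 hlt).le)
      have hσ := mul_smoothSign_eq hω (hR1.trans hx')
      obtain ⟨h₁, h₂⟩ := one_sub_abs_add_sq hσ (hR x hx')
      rw [add_sub_cancel] at h₁ h₂
      have h₃ := (hαβ _ h₁).1
      rw [h₂] at h₃
      rw [← ENNReal.ofReal_mul (by positivity), ← ENNReal.ofReal_pow (abs_nonneg _), sq_abs]
      refine ENNReal.ofReal_le_ofReal ?_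
      rw [le_inv_mul_iff₀ hα]
      exact h₃
  refine (lintegral_mono hle).trans_lt ?_
  rw [lintegral_add_left (measurable_const.indicator measurableSet_Icc),
    lintegral_indicator measurableSet_Icc, setLIntegral_const,
    lintegral_const_mul' _ _ ENNReal.ofReal_ne_top]
  exact ENNReal.add_lt_top.2 ⟨ENNReal.mul_lt_top (by simp) (by simp),
    ENNReal.mul_lt_top (by simp) hE⟩

/-- Truncating the tails of a profile changes the potential energy by an arbitrarily small
amount. -/
lemma tendsto_lintegral_potential (hW : IsDoubleWell W) (hω : ω = 1 ∨ ω = -1)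
    (hv : Continuous v) (ht : Tendsto v atTop (𝓝 ω)) (hb : Tendsto v atBot (𝓝 (-ω)))
    (hE : ∫⁻ x, ENNReal.ofReal (W (v x)) < ∞) :
    Tendsto (fun n : ℕ => ∫⁻ x, ENNReal.ofReal
      (W (v x - farCutoff n x * (v x - ω * smoothSign x)))) atTop
      (𝓝 (∫⁻ x, ENNReal.ofReal (W (v x)))) := by
  obtain ⟨R, hR1, hR⟩ := exists_abs_sub_le_one ht hb
  obtain ⟨α, β, hα, hβ, hαβ⟩ := hW.bounds
  have h2 := sqNorm_sub_smoothSign_lt_top hW hω hv ht hb hE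
  have hη := contDiff_smoothSign.continuous
  have hc : ∀ n, Continuous (farCutoff n) := fun n =>
    (isNullMultiplier_farCutoff.contDiff n).continuous
  have hWc := hW.continuous
  -- Where the cutoff vanishes the integrand is `W (v x)` itself; elsewhere, for large `n`, the
  -- truncated profile is no farther from its well than `v`, and the upper quadratic bound applies.
  -- Domination is thus only eventual in `n`.
  refine tendsto_lintegral_filter_of_dominated_convergence
    (fun x => ENNReal.ofReal (W (v x))
      + ENNReal.ofReal β * ‖v x - ω * smoothSign x‖ₑ ^ 2) ?_ ?_ ?_ ?_
  · refine Eventually.of_forall fun n => Measurable.ennreal_ofReal ?_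
    have := hc n
    exact Continuous.measurable (by fun_prop)
  · filter_upwards [eventually_ge_atTop ⌈R⌉₊] with n hn
    refine ae_of_all _ fun x => ?_
    have hRn : R ≤ n := Nat.le_of_ceil_le hn
    rcases le_or_gt |x| n with hx | hx
    · rw [farCutoff_eq_zero hx, zero_mul, sub_zero]
      exact le_self_add
    · refine le_trans ?_ le_add_self
      have hx' : R ≤ |x| := hRn.trans hx.le
      have hσ := mul_smoothSign_eq hω (hR1.trans hx')
      set u := v x - ω * smoothSign x with hu
      have hu1 : |u| ≤ 1 := hR x hx'
      have hθ : |1 - farCutoff n x| ≤ 1 :=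
        abs_le.2 ⟨by linarith [farCutoff_le_two n x], by linarith [farCutoff_nonneg n x]⟩
      have hθu : |(1 - farCutoff n x) * u| ≤ |u| := by
        rw [abs_mul]; exact mul_le_of_le_one_left (abs_nonneg _) hθ
      have e : v x - farCutoff n x * u = ω * smoothSign x + (1 - farCutoff n x) * u := by
        rw [hu]; ring
      obtain ⟨h₁, h₃⟩ := one_sub_abs_add_sq hσ (hθu.trans hu1)
      have h₄ := (hαβ _ h₁).2
      rw [h₃] at h₄
      rw [e, Real.enorm_eq_ofReal_abs, ← ENNReal.ofReal_pow (abs_nonneg _),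
        ← ENNReal.ofReal_mul hβ.le]
      refine ENNReal.ofReal_le_ofReal (h₄.trans ?_)
      exact mul_le_mul_of_nonneg_left (sq_le_sq.2 (by rwa [abs_abs])) hβ.le
  · have m : Measurable (fun x => ENNReal.ofReal (W (v x))) :=
      Measurable.ennreal_ofReal (hWc.comp hv).measurable
    rw [lintegral_add_left m, lintegral_const_mul' _ _ ENNReal.ofReal_ne_top]
    exact (ENNReal.add_lt_top.2 ⟨hE, ENNReal.mul_lt_top (by simp) h2⟩).ne
  · refine ae_of_all _ fun x => tendsto_const_nhds.congr' ?_
    filter_upwards [eventually_ge_atTop ⌈|x|⌉₊] with n hn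
    rw [farCutoff_eq_zero (Nat.le_of_ceil_le hn), zero_mul, sub_zero]

end Potential

/-! ### Truncating profiles and passing to the limit -/

section Approximation

variable {W : ℝ → ℝ} {k : ℕ} {s : ℝ} {a : ℝ × ℝ → ℝ} {ω : ℝ} {v : ℝ → ℝ}

lemma MemHLoc.isWeakDeriv (hv : MemHLoc k s v) {j : ℕ} (hj : j ≤ k) :
    IsWeakDeriv j v (weakDeriv j v) := by
  obtain ⟨g, hg⟩ := hv.exists_weakDeriv j hj
  exact hg.congr_right hg.weakDeriv_ae_eq.symm

/-- The difference of a profile of finite energy and the smooth transition is in `H^{k+s}(ℝ)`. -/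
lemma memHs_weakDeriv_sub_smoothSign (hs0 : 0 < s) (hs1 : s < 1) (hv : MemHLoc k s v)
    (hu : sqNorm (fun x => v x - ω * smoothSign x) < ∞)
    (hE : sqSemi s (weakDeriv k v) < ∞) :
    ∀ j ≤ k, MemHs s (fun x => weakDeriv j v x - ω * iteratedDeriv j smoothSign x) := by
  have hw : ∀ j ≤ k, IsWeakDeriv j (fun x => v x - ω * smoothSign x)
      (fun x => weakDeriv j v x - ω * iteratedDeriv j smoothSign x) := fun j hj =>
    (hv.isWeakDeriv hj).sub ((IsWeakDeriv.of_contDiff contDiff_smoothSign j).const_mul ω)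
  refine memHs_of_isWeakDeriv hs0 hs1
    (g := fun j x => weakDeriv j v x - ω * iteratedDeriv j smoothSign x) hu hw ?_
  have hvm := (hv.isWeakDeriv le_rfl).2.1.aestronglyMeasurable
  have hkm := (hw k le_rfl).2.1.aestronglyMeasurable
  obtain ⟨C, hC, hle⟩ := exists_sqIncr_iteratedDeriv_le (f := fun x => -ω * smoothSign x)
    (contDiff_const.mul contDiff_smoothSign)
    (fun x hx => by rw [smoothSign_of_one_le (le_of_lt hx)])
    (fun x hx => by rw [smoothSign_of_le_neg_one (le_of_lt hx)]) k
  have hη : iteratedDeriv k (fun x => -ω * smoothSign x)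
      = fun x => -ω * iteratedDeriv k smoothSign x := by
    ext x
    exact iteratedDeriv_const_mul_field (-ω) smoothSign
  have hηm : AEStronglyMeasurable (fun x => -ω * iteratedDeriv k smoothSign x) volume :=
    ((contDiff_iteratedDeriv contDiff_smoothSign k).continuous.const_mul
      (-ω)).aestronglyMeasurable
  rw [hη] at hle
  -- Only short increments are compared with those of `v⁽ᵏ⁾`: they give the `L²` bound by
  -- interpolation, and that bound then controls the long increments.
  have hbound : ∀ r ∈ Ioo (-1 : ℝ) 1,
      sqIncr (fun x => weakDeriv k v x - ω * iteratedDeriv k smoothSign x) r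
        ≤ 2 * sqIncr (weakDeriv k v) r + 2 * C * ENNReal.ofReal |r| ^ 2 := by
    intro r hr
    have e : (fun x => weakDeriv k v x - ω * iteratedDeriv k smoothSign x)
        = fun x => weakDeriv k v x + -ω * iteratedDeriv k smoothSign x := by ext x; ring
    rw [e, mul_assoc]
    refine (sqIncr_add_le hηm r).trans ?_
    gcongr
    exact hle r hr
  have hn : nearIncr (fun x => weakDeriv k v x - ω * iteratedDeriv k smoothSign x) < ∞ := by
    calc _ ≤ ∫⁻ r in Ioo (-1 : ℝ) 1, (2 * sqIncr (weakDeriv k v) r + 2 * C) := by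
          refine setLIntegral_mono' measurableSet_Ioo fun r hr => (hbound r hr).trans ?_
          refine add_le_add_right (mul_le_of_le_one_right'
            (pow_le_one₀ zero_le (ENNReal.ofReal_le_one.2 ?_))) _
          exact abs_le.2 ⟨hr.1.le, hr.2.le⟩
      _ = 2 * nearIncr (weakDeriv k v) + 2 * C * volume (Ioo (-1 : ℝ) 1) := by
          rw [lintegral_add_right _ measurable_const, lintegral_const_mul' _ _ (by simp),
            setLIntegral_const, nearIncr]
      _ < ∞ := ENNReal.add_lt_top.2 ⟨ENNReal.mul_lt_top (by simp)
            ((nearIncr_le_sqSemi hs0 _).trans_lt hE),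
          ENNReal.mul_lt_top (ENNReal.mul_lt_top (by simp) hC.lt_top) (by simp)⟩
  have h2 := (hw k le_rfl).sqNorm_lt_top hu hn
  refine ⟨hkm, h2, sqSemi_lt_top_of_le hs0 hs1 hkm h2 (A := fun r => 2 * sqIncr (weakDeriv k v) r)
    ?_ (ENNReal.mul_ne_top (by simp) hC) hbound⟩
  simp_rw [mul_left_comm (fracKernel s _) 2]
  rw [lintegral_const_mul' _ _ (by simp)]
  exact ENNReal.mul_lt_top (by simp) hE

/-- A profile of finite energy is approximated, in energy, by profiles of finite length. -/
lemma iInf_transitionEnergyAt_le_energy (hW : IsDoubleWell W) (hs0 : 0 < s) (hs1 : s < 1)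
    (ha : IsKernel a) (hω : ω = 1 ∨ ω = -1) (hv : v ∈ profiles k s ω) :
    ⨅ T : ℝ, ⨅ _ : 0 < T, transitionEnergyAt W k s a ω T ≤ energy W k s a v := by
  obtain ⟨hvH, hvc, ht, hb⟩ := hv
  by_cases hfin : energy W k s a v = ∞
  · rw [hfin]; exact le_top
  obtain ⟨α, β, hα, haα⟩ := ha.bounds
  have haβ : ∀ᵐ p : ℝ × ℝ, 0 ≤ a p ∧ a p ≤ β := haα.mono fun p hp => ⟨hα.le.trans hp.1, hp.2⟩
  have hEW : ∫⁻ x, ENNReal.ofReal (W (v x)) < ∞ := by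
    refine lt_of_le_of_lt ?_ (lt_top_iff_ne_top.2 hfin)
    rw [energy, energyOn, Measure.restrict_univ]
    exact le_self_add
  have hEG : gagliardo a s univ (weakDeriv k v) < ∞ := by
    refine lt_of_le_of_lt ?_ (lt_top_iff_ne_top.2 hfin)
    rw [energy, energyOn]
    exact le_add_self
  have hvm := (hvH.isWeakDeriv le_rfl).2.1.aestronglyMeasurable
  have hEs : sqSemi s (weakDeriv k v) < ∞ := by
    rw [← gagliardo_one_univ hvm]
    exact (gagliardo_one_le hα (haα.mono fun p hp => hp.1)).trans_lt
      (ENNReal.mul_lt_top (by simp) hEG)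
  set u : ℝ → ℝ := fun x => v x - ω * smoothSign x with hu
  have hu2 : sqNorm u < ∞ := sqNorm_sub_smoothSign_lt_top hW hω hvc ht hb hEW
  have huc : Continuous u := hvc.sub (continuous_const.mul contDiff_smoothSign.continuous)
  set g : ℕ → ℝ → ℝ := fun j x => weakDeriv j v x - ω * iteratedDeriv j smoothSign x with hg
  have hgw : ∀ j ≤ k, IsWeakDeriv j u (g j) := fun j hj =>
    (hvH.isWeakDeriv hj).sub ((IsWeakDeriv.of_contDiff contDiff_smoothSign j).const_mul ω)
  have hgs : ∀ j ≤ k, MemHs s (g j) := memHs_weakDeriv_sub_smoothSign hs0 hs1 hvH hu2 hEs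
  -- `weakDeriv 0 v` is a chosen representative, equal to `v` only almost everywhere.
  have hg0 : g 0 =ᵐ[volume] u :=
    (hgw 0 (Nat.zero_le k)).ae_unique (IsWeakDeriv.zero huc.locallyIntegrable)
  have hr : ∀ j ≤ k, ∃ r : ℕ → ℝ → ℝ, (∀ n, IsWeakDeriv j (fun x => farCutoff n x * u x) (r n)) ∧
      (∀ n, MemHs s (r n)) ∧ Tendsto (fun n => sqSemi s (r n)) atTop (𝓝 0) := by
    intro j hj
    obtain ⟨r, h₁, h₂, h₃⟩ := isNullMultiplier_farCutoff.exists_isWeakDeriv hs0 hs1 j (g := g)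
      (fun i hi => (hgw i (by omega)).one_of_succ (hgw (i + 1) (by omega)))
      (fun i hi => hgs i (by omega))
    exact ⟨r, fun n => (h₁ n).congr_left ((ae_eq_refl (farCutoff n)).mul hg0), h₂, h₃⟩
  choose! r hrw hrs hrt using hr
  set w : ℕ → ℝ → ℝ := fun n x => v x - farCutoff n x * u x with hw
  have hww : ∀ j ≤ k, ∀ n, IsWeakDeriv j (w n) (fun x => weakDeriv j v x - r j n x) :=
    fun j hj n => (hvH.isWeakDeriv hj).sub (hrw j hj n)
  have hwH : ∀ n, MemHLoc k s (w n) := by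
    intro n
    refine ⟨fun j hj => ⟨_, hww j hj n⟩, fun j hj R => ?_, fun R => ?_⟩
    · refine MemLp.ae_eq (ae_restrict_of_ae (hww j hj n).weakDeriv_ae_eq.symm) ?_
      exact (hvH.memLp j hj R).sub (((sqNorm_lt_top_iff (hrs j hj n).1).1
        (hrs j hj n).2).restrict _)
    · rw [gagliardo_congr (hww k le_rfl n).weakDeriv_ae_eq]
      refine (gagliardo_sub_le (β := 1) one_pos (ae_of_all _ fun p => ⟨zero_le_one, le_rfl⟩)
        (hrs k le_rfl n).1).trans_lt ?_
      rw [gagliardo_one_univ (hrs k le_rfl n).1]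
      exact ENNReal.add_lt_top.2 ⟨ENNReal.mul_lt_top (by simp) (hvH.seminorm_lt_top R),
        ENNReal.mul_lt_top (by simp) (hrs k le_rfl n).3⟩
  -- For `|x| > n + 1` the cutoff is one, and `v - u` is exactly `ω * smoothSign`.
  have hwp : ∀ n : ℕ, w n ∈ profilesAt k s ω (n + 1) := by
    intro n
    refine ⟨hwH n, hvc.sub ((isNullMultiplier_farCutoff.contDiff n).continuous.mul huc),
      fun x hx => ?_⟩
    have hn : (0 : ℝ) ≤ n := n.cast_nonneg
    rw [hw, ← smoothSign_eq_sign (by linarith)]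
    simp only [farCutoff_eq_one hx.le, hu]
    ring
  have hle : ∀ n, ⨅ T : ℝ, ⨅ _ : 0 < T, transitionEnergyAt W k s a ω T ≤ energy W k s a (w n) :=
    fun n => (iInf₂_le (n + 1 : ℝ) (by positivity)).trans (iInf₂_le (w n) (hwp n))
  set m := ⨅ T : ℝ, ⨅ _ : 0 < T, transitionEnergyAt W k s a ω T
  -- For fixed `δ` the remainder has the finite constant `(1 + δ⁻¹) * β` and vanishes as `n → ∞`;
  -- only afterwards may `δ` tend to zero.
  have hδ : ∀ δ : ℝ, 0 < δ → m ≤ (∫⁻ x, ENNReal.ofReal (W (v x)))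
      + ENNReal.ofReal (1 + δ) * gagliardo a s univ (weakDeriv k v) := by
    intro δ hδ
    have hlim : Tendsto (fun n => (∫⁻ x, ENNReal.ofReal (W (w n x)))
        + (ENNReal.ofReal (1 + δ) * gagliardo a s univ (weakDeriv k v)
          + ENNReal.ofReal ((1 + δ⁻¹) * β) * sqSemi s (r k n))) atTop
        (𝓝 ((∫⁻ x, ENNReal.ofReal (W (v x)))
          + (ENNReal.ofReal (1 + δ) * gagliardo a s univ (weakDeriv k v)
            + ENNReal.ofReal ((1 + δ⁻¹) * β) * 0))) :=
      (tendsto_lintegral_potential hW hω hvc ht hb hEW).add (tendsto_const_nhds.add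
        (ENNReal.Tendsto.const_mul (hrt k le_rfl) (Or.inr ENNReal.ofReal_ne_top)))
    rw [mul_zero, add_zero] at hlim
    refine ge_of_tendsto' hlim fun n => (hle n).trans ?_
    rw [energy, energyOn, Measure.restrict_univ,
      gagliardo_congr (hww k le_rfl n).weakDeriv_ae_eq, ← gagliardo_one_univ (hrs k le_rfl n).1]
    gcongr
    exact gagliardo_sub_le hδ haβ (hrs k le_rfl n).1
  have hlim : Tendsto (fun δ : ℝ => (∫⁻ x, ENNReal.ofReal (W (v x)))
      + ENNReal.ofReal (1 + δ) * gagliardo a s univ (weakDeriv k v)) (𝓝[>] 0)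
      (𝓝 ((∫⁻ x, ENNReal.ofReal (W (v x)))
        + ENNReal.ofReal (1 + 0) * gagliardo a s univ (weakDeriv k v))) := by
    refine tendsto_const_nhds.add (ENNReal.Tendsto.mul_const ?_ (Or.inr hEG.ne))
    refine ENNReal.tendsto_ofReal ?_
    exact (tendsto_const_nhds.add tendsto_id).mono_left nhdsWithin_le_nhds
  have := ge_of_tendsto hlim (eventually_mem_nhdsWithin.mono fun δ h => hδ δ h)
  rwa [add_zero, ENNReal.ofReal_one, one_mul, ← Measure.restrict_univ (μ := volume)] at this

/-- A larger `T` constrains fewer points, so the class of competitors grows. -/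
lemma transitionEnergyAt_antitone (W : ℝ → ℝ) (k : ℕ) (s : ℝ) (a : ℝ × ℝ → ℝ) (ω : ℝ) :
    Antitone (transitionEnergyAt W k s a ω) := fun _ _ hT =>
  biInf_mono fun _ hv => ⟨hv.1, hv.2.1, fun x hx => hv.2.2 x (hT.trans_lt hx)⟩

lemma profilesAt_subset_profiles (k : ℕ) (s ω T : ℝ) : profilesAt k s ω T ⊆ profiles k s ω := by
  rintro v ⟨hv, hc, h⟩
  refine ⟨hv, hc, tendsto_const_nhds.congr' ?_, tendsto_const_nhds.congr' ?_⟩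
  · filter_upwards [eventually_gt_atTop (max T 0)] with x hx
    have hx0 : 0 < x := (le_max_right _ _).trans_lt hx
    rw [h x ((le_max_left _ _).trans_lt (hx.trans_le (le_abs_self x))), Real.sign_of_pos hx0,
      mul_one]
  · filter_upwards [eventually_lt_atBot (min (-T) 0)] with x hx
    have hx0 : x < 0 := hx.trans_le (min_le_right _ _)
    have hxT : x < -T := hx.trans_le (min_le_left _ _)
    rw [h x (by rw [abs_of_neg hx0]; linarith), Real.sign_of_neg hx0, mul_neg, mul_one]

end Approximation

end FracPhase

end

theorem corollary4p4 (W : ℝ → ℝ) (hW : FracPhase.IsDoubleWell W)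
    (k : ℕ) (s : ℝ) (hs0 : 0 < s) (hs1 : s < 1) (hks : 1 / 2 < (k : ℝ) + s)
    (a : ℝ × ℝ → ℝ) (ha : FracPhase.IsKernel a)
    (ω : ℝ) (hω : ω = 1 ∨ ω = -1) :
    Tendsto (fun T : ℝ => FracPhase.transitionEnergyAt W k s a ω T) atTop
        (𝓝 (FracPhase.transitionEnergy W k s a ω)) ∧
      FracPhase.transitionEnergy W k s a ω =
        ⨅ T : ℝ, ⨅ _ : 0 < T, FracPhase.transitionEnergyAt W k s a ω T := by
  have anti := FracPhase.transitionEnergyAt_antitone W k s a ω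
  have heq : FracPhase.transitionEnergy W k s a ω =
      ⨅ T : ℝ, ⨅ _ : 0 < T, FracPhase.transitionEnergyAt W k s a ω T :=
    le_antisymm
      (le_iInf₂ fun T _ => biInf_mono fun _ hv => FracPhase.profilesAt_subset_profiles k s ω T hv)
      (le_iInf₂ fun _ hv => FracPhase.iInf_transitionEnergyAt_le_energy hW hs0 hs1 ha hω hv)
  -- Monotone convergence yields the infimum over all real `T`; nonpositive lengths do not lower it,
  -- since passing to `max T 1` can only decrease the energy.
  have hpos : ⨅ T : ℝ, ⨅ _ : 0 < T, FracPhase.transitionEnergyAt W k s a ω T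
      = ⨅ T : ℝ, FracPhase.transitionEnergyAt W k s a ω T :=
    le_antisymm
      (le_iInf fun T => (iInf₂_le (max T 1) (by positivity)).trans (anti (le_max_left T 1)))
      (le_iInf₂ fun T _ => iInf_le _ T)
  refine ⟨?_, heq⟩
  rw [heq, hpos]
  exact tendsto_atTop_iInf anti
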